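/- Let $n\ge 2$ and let $\mathbb S^n$ be the Euclidean unit sphere in $\mathbb R^{n+1}$. A spherical convex body is a closed set $K\subseteq\mathbb S^n$ whose radial extension $\{rv : r\ge 0,\ v\in K\}$ is convex in $\mathbb R^{n+1}$. For a spherical convex body $K$ and a Borel set $\omega\subseteq\mathbb S^n$, the floating measure is $$\Omega(K,\omega)=\int_{\omega\cap \operatorname{bd}K} H_{n-1}^{\mathbb S^n}(K,w)^{\frac1{n+1}}\,d\mathcal H^{n-1}(w),$$ where $\operatorname{bd}K$ is the boundary of $K$ in $\mathbb S^n$, $\mathcal H^{n-1}$ is the $(n-1)$-dimensional Hausdorff measure, and $H_{n-1}^{\mathbb S^n}(K,w)$ is the generalized spherical Gauss–Kronecker curvature of $K$ at $w$. That is, $H_{n-1}^{\mathbb S^n}(K,w)$ is the generalized Gauss–Kronecker curvature at the origin of the image of $\{v\in K : w\cdot v>0\}$ in $w^\perp$ under the gnomonic projection $g_w(v)=\frac{v}{w\cdot v}-w$. Here a convex set $L$ in a Euclidean space has generalized Gauss–Kronecker curvature $\det A$ at a boundary point $x$ if it has a unique outer unit normal $N$ at $x$ and the function $f(y)=\inf\{t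 : x+y-tN\in L\}$, $y\in N^\perp$, satisfies $f(y)=\frac12 (Ay)\cdot y+o(\|y\|^2)$ as $y\to0$ for some symmetric linear map $A:N^\perp\to N^\perp$; where no such expansion exists, the curvature is set equal to $0$. Theorem 7.2. The floating measure is a valuation: if $K$, $L$ and $K\cup L$ are spherical convex bodies in $\mathbb S^n$, then for every Borel set $\omega\subseteq\mathbb S^n$, $$\Omega(K,\omega)+\Omega(L,\omega)=\Omega(K\cup L,\omega)+\Omega(K\cap L,\omega).$$ -/

import Mathlib

open MeasureTheory Set Filter Topology Asymptotics
open scoped RealInnerProductSpace ENNReal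

noncomputable section

/-- The ambient Euclidean space `ℝ^(n+1)`. -/
abbrev Ambient (n : ℕ) : Type := EuclideanSpace ℝ (Fin (n + 1))

/-- The Euclidean unit sphere `𝕊^n` in `ℝ^(n+1)`. Its interiors, boundaries and Borel sets are those
of the sphere itself (subspace topology). -/
abbrev USphere (n : ℕ) : Type := Metric.sphere (0 : Ambient n) 1

/-- The radial extension `rad A = {r v : r ≥ 0, v ∈ A}` of a subset of the sphere. -/
def radialExtension {n : ℕ} (A : Set (USphere n)) : Set (Ambient n) :=
  {x | ∃ r : ℝ, 0 ≤ r ∧ ∃ v ∈ A, x = r • (v : Ambient n)}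

/-- A spherical convex body: a closed subset of the sphere whose radial extension is convex. It may
be non-proper, have empty interior, be all of the sphere, or be empty. -/
def IsSphericalConvexBody {n : ℕ} (K : Set (USphere n)) : Prop :=
  IsClosed K ∧ Convex ℝ (radialExtension K)

section Euclidean

variable {E : Type*} [NormedAddCommGroup E] [InnerProductSpace ℝ E]

/-- `N` is an outer unit normal vector of the set `L` at the point `x`. -/
def IsOuterUnitNormal (L : Set E) (x N : E) : Prop :=
  ‖N‖ = 1 ∧ ∀ z ∈ L, ⟪z - x, N⟫ ≤ 0

/-- The function whose graph over the hyperplane `x + N^⊥` describes the part of the boundary of `L`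
near `x`: its value at `y` is the least height `t` with `x + y - t N ∈ L`. -/
def boundaryFunction (L : Set E) (x N : E) (y : (ℝ ∙ N)ᗮ) : ℝ :=
  sInf {t : ℝ | x + (y : E) - t • N ∈ L}

/-- `L` has generalized Gauss-Kronecker curvature `k` at `x`: there is exactly one outer unit normal
`N` of `L` at `x`, the boundary function `f` of `L` at `x` has a second order expansion
`f y = ⟪A y, y⟫ / 2 + o(‖y‖ ^ 2)` as `y → 0`, with `A` a symmetric endomorphism of the tangent
space `N^⊥`, and `k = det A` (the product of the principal curvatures). -/
def HasGaussKroneckerCurvature (L : Set E) (x : E) (k : ℝ) : Prop :=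
  ∃ N : E, IsOuterUnitNormal L x N ∧ (∀ N' : E, IsOuterUnitNormal L x N' → N' = N) ∧
    ∃ A : (ℝ ∙ N)ᗮ →ₗ[ℝ] (ℝ ∙ N)ᗮ, A.IsSymmetric ∧
      (fun y : (ℝ ∙ N)ᗮ => boundaryFunction L x N y - ⟪A y, y⟫ / 2)
        =o[𝓝 0] (fun y : (ℝ ∙ N)ᗮ => ‖y‖ ^ 2) ∧
      k = LinearMap.det A

open Classical in
/-- The generalized Gauss-Kronecker curvature of the convex set `L` at `x`, with the value `0` at the
points where it does not exist. (It exists almost everywhere on the boundary if `L` is closed and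
has non-empty interior; a set inside a hyperplane has no point with a unique outer unit normal, so
that the value is `0` throughout.) -/
def gaussKroneckerCurvature (L : Set E) (x : E) : ℝ :=
  if h : ∃ k : ℝ, HasGaussKroneckerCurvature L x k then h.choose else 0

end Euclidean

/-- The gnomonic projection `v ↦ v / ⟪w, v⟫ - w`, for `v` in the open hemisphere with center `w`. -/
def gnomonic {n : ℕ} (w v : USphere n) : Ambient n :=
  (⟪(w : Ambient n), (v : Ambient n)⟫)⁻¹ • (v : Ambient n) - (w : Ambient n)

/-- The image, in the tangent space `w^⊥`, of the part of `K` in the open hemisphere with center `w`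
under the gnomonic projection at `w`. -/
def gnomonicImage {n : ℕ} (w : USphere n) (K : Set (USphere n)) :
    Set (ℝ ∙ (w : Ambient n))ᗮ :=
  {x | ∃ v ∈ K, 0 < ⟪(w : Ambient n), (v : Ambient n)⟫ ∧ (x : Ambient n) = gnomonic w v}

/-- The spherical Gauss-Kronecker curvature of `K` at `w`: the Euclidean Gauss-Kronecker curvature at
the origin of the gnomonic projection of `K` at `w` (whose differential at `w` is the identity). -/
def sphericalCurvature {n : ℕ} (K : Set (USphere n)) (w : USphere n) : ℝ :=
  gaussKroneckerCurvature (gnomonicImage w K) 0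

/-- The floating measure `Ω(K, ω)`: the integral of the spherical Gauss-Kronecker curvature, raised
to the power `1 / (n + 1)`, over `ω ∩ bd K` with respect to the `(n - 1)`-dimensional Hausdorff
measure (with the usual normalization). -/
def floatingMeasure {n : ℕ} (K ω : Set (USphere n)) : ℝ≥0∞ :=
  ∫⁻ w in ω ∩ frontier K,
    ENNReal.ofReal (sphericalCurvature K w ^ (1 / ((n : ℝ) + 1))) ∂μHE[n - 1]

end

/-! ### Second-order expansions of convex functions that touch -/

section QuadraticExpansion

variable {V : Type*} [NormedAddCommGroup V] [InnerProductSpace ℝ V] [FiniteDimensional ℝ V]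

/-! Cut the boundaries of `K` and `L` along each other. Near a boundary point of `K` outside `L`,
the bodies `K ∪ L` and `K` coincide; near one interior to `L`, the bodies `K ∩ L` and `K` do. There
the curvatures match pointwise. What remains is the common boundary `frontier K ∩ frontier L`.

Where the common boundary is interior to `K ∪ L`, the supporting hyperplanes of `K` and `L` are
opposite. Then `K` and `L` are flat to second order and `K ∩ L` lies in a hyperplane, so all three
curvatures vanish (`sphericalCurvature_eq_zero_of_union_mem_nhds`). Where it lies on `frontier (K ∪
L)`, each of `K`, `L`, `K ∩ L` sits inside `K ∪ L` and touches its boundary. It then suffices that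
nested bodies `A ⊆ B` have equal curvature at almost every contact point
(`euclideanHausdorffMeasure_sphericalCurvature_ne`).

For this, flatten `frontier B` by a local bi-Lipschitz projection. Almost every contact point is a
Lebesgue density point of the contact set, so around it every boundary point of `B` has a contact
point at relatively negligible distance (`NonporousAt`). Convexity turns this weak density into
second-order information: if two ordered boundary functions agree on such a set, an expansion of
either one passes to the other, by separation when the lower one is expanded and by reflection when
the upper one is. Hence the curvatures agree, default value included
(`gaussKroneckerCurvature_eq_of_nonporousAt`). Neither almost everywhere existence of expansions nor
measurability of the curvature is needed. -/

lemma exists_abs_quadratic_sub_le (A : V →ₗ[ℝ] V) :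
    ∃ C : ℝ, 0 < C ∧ (∀ z y : V, |⟪A z, z⟫ / 2 - ⟪A y, y⟫ / 2| ≤ C * (‖z‖ + ‖y‖) * ‖z - y‖) ∧
      ∀ y : V, |⟪A y, y⟫ / 2| ≤ C * ‖y‖ ^ 2 := by
  have key : ∃ C : ℝ, 0 < C ∧
      ∀ z y : V, |⟪A z, z⟫ / 2 - ⟪A y, y⟫ / 2| ≤ C * (‖z‖ + ‖y‖) * ‖z - y‖ := by
    set C := ‖A.toContinuousLinearMap‖
    have hC : ∀ x, ‖A x‖ ≤ C * ‖x‖ := A.toContinuousLinearMap.le_opNorm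
    have hC0 : 0 ≤ C := norm_nonneg _
    refine ⟨C + 1, by positivity, fun z y => ?_⟩
    have h : ⟪A z, z⟫ / 2 - ⟪A y, y⟫ / 2 = (⟪A (z - y), z⟫ + ⟪A y, z - y⟫) / 2 := by
      simp only [map_sub, inner_sub_left, inner_sub_right]; ring
    have h1 : |⟪A (z - y), z⟫| ≤ C * ‖z - y‖ * ‖z‖ :=
      (abs_real_inner_le_norm _ _).trans (by gcongr; exact hC _)
    have h2 : |⟪A y, z - y⟫| ≤ C * ‖y‖ * ‖z - y‖ :=
      (abs_real_inner_le_norm _ _).trans (by gcongr; exact hC _)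
    have h3 := abs_add_le ⟪A (z - y), z⟫ ⟪A y, z - y⟫
    rw [h, abs_div, abs_two]
    have h4 : 0 ≤ ‖z‖ * ‖z - y‖ := by positivity
    have h5 : 0 ≤ ‖y‖ * ‖z - y‖ := by positivity
    have h6 : 0 ≤ C * (‖z‖ * ‖z - y‖) := by positivity
    have h7 : 0 ≤ C * (‖y‖ * ‖z - y‖) := by positivity
    nlinarith
  obtain ⟨C, hC0, hC⟩ := key
  refine ⟨C, hC0, hC, fun y => ?_⟩
  have := hC y 0
  simp only [map_zero, inner_zero_left, zero_div, sub_zero, norm_zero, add_zero] at this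
  rwa [pow_two, ← mul_assoc]

lemma exists_forall_norm_lt_of_isLittleO {V : Type*} [NormedAddCommGroup V] {f : V → ℝ}
    (h : f =o[𝓝 0] fun y : V => ‖y‖ ^ 2) {c : ℝ} (hc : 0 < c) :
    ∃ δ > 0, ∀ y : V, ‖y‖ < δ → |f y| ≤ c * ‖y‖ ^ 2 := by
  obtain ⟨δ, hδ, H⟩ := Metric.eventually_nhds_iff.1 (isLittleO_iff.1 h hc)
  refine ⟨δ, hδ, fun y hy => ?_⟩
  simpa using H (y := y) (by simpa using hy)

lemma isLittleO_sq_iff {V : Type*} [NormedAddCommGroup V] {f : V → ℝ} :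
    (f =o[𝓝 0] fun y : V => ‖y‖ ^ 2) ↔
      ∀ c : ℝ, 0 < c → ∃ δ > 0, ∀ y : V, ‖y‖ < δ → |f y| ≤ c * ‖y‖ ^ 2 := by
  refine ⟨fun h c hc => exists_forall_norm_lt_of_isLittleO h hc, fun h => ?_⟩
  refine isLittleO_iff.2 fun c hc => ?_
  obtain ⟨δ, hδ, H⟩ := h c hc
  refine Metric.eventually_nhds_iff.2 ⟨δ, hδ, fun y hy => ?_⟩
  simpa using H y (by simpa using hy)

/-- Two functions are said to touch densely at the origin if near every small `y` there is, up to an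
error small compared with `‖y‖`, a point where they agree. -/
def TouchDensely (f g : V → ℝ) : Prop :=
  ∀ ε : ℝ, 0 < ε → ∃ δ > 0, ∀ y : V, ‖y‖ < δ → ∃ z : V, ‖z - y‖ ≤ ε * ‖y‖ ∧ g z = f z

/-- A convex majorant touching densely a function with a second order expansion has the same
expansion. -/
lemma ConvexOn.isLittleO_of_touchDensely_of_le {f g : V → ℝ} {ρ : ℝ} (hρ : 0 < ρ)
    (hg : ConvexOn ℝ (Metric.ball 0 ρ) g) (hfg : ∀ y : V, ‖y‖ < ρ → f y ≤ g y)
    (ht : TouchDensely f g) {A : V →ₗ[ℝ] V}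
    (hf : (fun y => f y - ⟪A y, y⟫ / 2) =o[𝓝 0] fun y : V => ‖y‖ ^ 2) :
    (fun y => g y - ⟪A y, y⟫ / 2) =o[𝓝 0] fun y : V => ‖y‖ ^ 2 := by
  obtain ⟨C, hC0, hC, -⟩ := exists_abs_quadratic_sub_le A
  refine isLittleO_sq_iff.2 fun c hc => ?_
  -- Over the ball of radius `η * ‖y‖` about `y` the quadratic form varies by at most `c / 2 * ‖y‖ ^
  -- 2`. The tolerance `c / 8` below costs another `c / 2`, as points of that ball have norm up to
  -- `2 * ‖y‖`.
  obtain ⟨η, hη, hη1, hηC⟩ : ∃ η : ℝ, 0 < η ∧ η ≤ 1 ∧ 3 * C * η ≤ c / 2 := by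
    refine ⟨min 1 (c / (6 * C)), by positivity, min_le_left _ _, ?_⟩
    calc 3 * C * min 1 (c / (6 * C)) ≤ 3 * C * (c / (6 * C)) := by gcongr; exact min_le_right _ _
      _ = c / 2 := by field_simp; norm_num
  obtain ⟨δ₁, hδ₁, hf₁⟩ := exists_forall_norm_lt_of_isLittleO hf (c := c / 8) (by positivity)
  obtain ⟨δ₂, hδ₂, ht₂⟩ := ht (η / 4) (by positivity)
  refine ⟨min (min (δ₁ / 2) (δ₂ / 2)) (ρ / 2), by positivity, fun y hy => ?_⟩
  simp only [lt_min_iff] at hy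
  obtain ⟨⟨hy1, hy2⟩, hyρ⟩ := hy
  have hy0 := norm_nonneg y
  set t := ⟪A y, y⟫ / 2 + c * ‖y‖ ^ 2 with ht_def
  have hball : ∀ z ∈ Metric.closedBall y (η * ‖y‖), ‖z‖ ≤ 2 * ‖y‖ := fun z hz => by
    rw [mem_closedBall_iff_norm] at hz
    have : ‖z‖ ≤ ‖y‖ + ‖z - y‖ := by simpa using norm_add_le y (z - y)
    nlinarith
  have hsub : Metric.closedBall y (η * ‖y‖) ⊆ Metric.ball 0 ρ := fun z hz => by
    have := hball z hz
    rw [mem_ball_zero_iff]; linarith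
  set G := {z ∈ Metric.closedBall y (η * ‖y‖) | g z ≤ t}
  have hGconv : Convex ℝ G := (hg.subset hsub (convex_closedBall _ _)).convex_le t
  have hGclosed : IsClosed G :=
    ((hg.continuousOn Metric.isOpen_ball).mono hsub).preimage_isClosed_of_isClosed
      Metric.isClosed_closedBall isClosed_Iic
  have hG : ∀ z ∈ Metric.closedBall y (η * ‖y‖), g z = f z → z ∈ G := fun z hz hgf => by
    refine ⟨hz, ?_⟩
    have hz2 := hball z hz
    have h1 := abs_le.1 (hf₁ z (by linarith))
    have h2 := abs_le.1 (hC z y)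
    rw [mem_closedBall_iff_norm] at hz
    have h3 : C * (‖z‖ + ‖y‖) * ‖z - y‖ ≤ C * (3 * ‖y‖) * (η * ‖y‖) := by
      gcongr; linarith
    have h4 : C * (3 * ‖y‖) * (η * ‖y‖) ≤ c / 2 * ‖y‖ ^ 2 := by
      calc _ = (3 * C * η) * ‖y‖ ^ 2 := by ring
        _ ≤ _ := by gcongr
    have h5 : ‖z‖ ^ 2 ≤ (2 * ‖y‖) ^ 2 := by gcongr
    rw [hgf]; nlinarith
  -- The contact points in the ball all lie in the closed convex sublevel set `G`. Were `y` outside,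
  -- a hyperplane would separate it from `G`; moving from `y` away from `G` by half the radius
  -- leaves room for a contact point on the wrong side.
  have hyG : y ∈ G := by
    by_contra hyG
    obtain ⟨φ, u, hφy, hφ⟩ := geometric_hahn_banach_point_closed hGconv hGclosed hyG
    set e := (InnerProductSpace.toDual ℝ V).symm φ
    have he : ∀ x, φ x = ⟪e, x⟫ := fun x => (InnerProductSpace.toDual_symm_apply).symm
    set v := ‖e‖⁻¹ • e
    have hv : ‖v‖ ≤ 1 := by
      rw [norm_smul, norm_inv, norm_norm]; exact inv_mul_le_one
    have hev : ⟪e, v⟫ = ‖e‖ := by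
      rw [real_inner_smul_right, real_inner_self_eq_norm_sq]
      rcases eq_or_ne ‖e‖ 0 with h | h
      · simp [h]
      · field_simp
    set p := y - (η / 2 * ‖y‖) • v with hp
    have hpy : ‖p - y‖ ≤ η / 2 * ‖y‖ := by
      rw [hp, sub_sub_cancel_left, norm_neg, norm_smul, Real.norm_of_nonneg (by positivity)]
      exact mul_le_of_le_one_right (by positivity) hv
    have hpn : ‖p‖ ≤ 3 / 2 * ‖y‖ := by
      have : ‖p‖ ≤ ‖y‖ + ‖p - y‖ := by simpa using norm_add_le y (p - y)
      nlinarith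
    obtain ⟨z, hzp, hzt⟩ := ht₂ p (by linarith)
    have hzp' : ‖z - p‖ ≤ η / 2 * ‖y‖ := hzp.trans (by nlinarith)
    have hz : z ∈ Metric.closedBall y (η * ‖y‖) := by
      rw [mem_closedBall_iff_norm]
      have : ‖z - y‖ ≤ ‖z - p‖ + ‖p - y‖ := norm_sub_le_norm_sub_add_norm_sub _ _ _
      linarith
    have h1 := hφ z (hG z hz hzt)
    rw [he] at h1 hφy
    have h2 : ⟪e, z⟫ = ⟪e, y⟫ - (η / 2 * ‖y‖) * ‖e‖ + ⟪e, z - p⟫ := by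
      rw [inner_sub_right, hp, inner_sub_right, real_inner_smul_right, hev]; ring
    have h3 : ⟪e, z - p⟫ ≤ ‖e‖ * (η / 2 * ‖y‖) :=
      (real_inner_le_norm _ _).trans (by gcongr)
    linarith
  have h1 := abs_le.1 (hf₁ y (by linarith))
  have h2 := hfg y (by linarith)
  have h3 := hyG.2
  have h4 : 0 ≤ ‖y‖ ^ 2 := by positivity
  rw [abs_le]
  constructor <;> nlinarith

/-- A convex minorant touching densely a function with a second order expansion has the same
expansion. -/
lemma ConvexOn.isLittleO_of_touchDensely_of_ge {f g : V → ℝ} {ρ : ℝ} (hρ : 0 < ρ)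
    (hf : ConvexOn ℝ (Metric.ball 0 ρ) f) (hfg : ∀ y : V, ‖y‖ < ρ → f y ≤ g y)
    (ht : TouchDensely f g) {A : V →ₗ[ℝ] V}
    (hg : (fun y => g y - ⟪A y, y⟫ / 2) =o[𝓝 0] fun y : V => ‖y‖ ^ 2) :
    (fun y => f y - ⟪A y, y⟫ / 2) =o[𝓝 0] fun y : V => ‖y‖ ^ 2 := by
  obtain ⟨C, hC0, hC, -⟩ := exists_abs_quadratic_sub_le A
  refine isLittleO_sq_iff.2 fun c hc => ?_
  obtain ⟨η, hη, hη1, hηC⟩ : ∃ η : ℝ, 0 < η ∧ η ≤ 1 / 2 ∧ 30 * C * η ≤ c / 2 := by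
    refine ⟨min (1 / 2) (c / (60 * C)), by positivity, min_le_left _ _, ?_⟩
    calc 30 * C * min (1 / 2) (c / (60 * C)) ≤ 30 * C * (c / (60 * C)) := by
          gcongr; exact min_le_right _ _
      _ = c / 2 := by field_simp; norm_num
  obtain ⟨δ₁, hδ₁, hg₁⟩ := exists_forall_norm_lt_of_isLittleO hg (c := c / 40) (by positivity)
  obtain ⟨δ₂, hδ₂, ht₂⟩ := ht η (by positivity)
  refine ⟨min (min (δ₁ / 2) δ₂) (ρ / 2), by positivity, fun y hy => ?_⟩
  simp only [lt_min_iff] at hy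
  obtain ⟨⟨hy1, hy2⟩, hyρ⟩ := hy
  have hy0 := norm_nonneg y
  obtain ⟨z, hzy, hzt⟩ := ht₂ y hy2
  -- Reflect `y` in the contact point `z`: midpoint convexity gives `f y ≥ 2 * f z - f x ≥ 2 * g z -
  -- g x`, and both terms on the right have known expansions.
  set x := z + (z - y) with hx
  have hz2 : ‖z‖ ≤ 2 * ‖y‖ := by
    have : ‖z‖ ≤ ‖y‖ + ‖z - y‖ := by simpa using norm_add_le y (z - y)
    nlinarith
  have hx2 : ‖x‖ ≤ 2 * ‖y‖ := by
    have h1 : ‖x‖ ≤ ‖y‖ + (‖z - y‖ + ‖z - y‖) := by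
      have : x = y + ((z - y) + (z - y)) := by rw [hx]; abel
      rw [this]
      exact (norm_add_le _ _).trans (by gcongr; exact norm_add_le _ _)
    nlinarith
  have hmid : f z ≤ (1 / 2) * f y + (1 / 2) * f x := by
    have h := hf.2 (x := y) (by rw [mem_ball_zero_iff]; linarith) (y := x)
      (by rw [mem_ball_zero_iff]; linarith)
      (show (0 : ℝ) ≤ 1 / 2 by norm_num) (show (0 : ℝ) ≤ 1 / 2 by norm_num) (by norm_num)
    have hxz : (1 / 2 : ℝ) • y + (1 / 2 : ℝ) • x = z := by
      rw [hx]; module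
    rwa [hxz, smul_eq_mul, smul_eq_mul] at h
  have hfx := hfg x (by linarith)
  have hfy := hfg y (by linarith)
  have hgx := abs_le.1 (hg₁ x (by linarith))
  have hgz := abs_le.1 (hg₁ z (by linarith))
  have hgy := abs_le.1 (hg₁ y (by linarith))
  have hqz := abs_le.1 (hC z y)
  have hqx := abs_le.1 (hC x y)
  have hxy : ‖x - y‖ ≤ 2 * (η * ‖y‖) := by
    have h1 : x - y = (z - y) + (z - y) := by rw [hx]; abel
    rw [h1]
    exact (norm_add_le _ _).trans (by linarith)
  have e1 : C * (‖z‖ + ‖y‖) * ‖z - y‖ ≤ 3 * (C * η * ‖y‖ ^ 2) := by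
    calc _ ≤ C * (3 * ‖y‖) * (η * ‖y‖) := by gcongr; linarith
      _ = _ := by ring
  have e2 : C * (‖x‖ + ‖y‖) * ‖x - y‖ ≤ 6 * (C * η * ‖y‖ ^ 2) := by
    calc _ ≤ C * (3 * ‖y‖) * (2 * (η * ‖y‖)) := by gcongr; linarith
      _ = _ := by ring
  have e3 : 30 * (C * η * ‖y‖ ^ 2) ≤ c / 2 * ‖y‖ ^ 2 := by
    calc _ = (30 * C * η) * ‖y‖ ^ 2 := by ring
      _ ≤ _ := by gcongr
  have e4 : c / 40 * ‖z‖ ^ 2 ≤ c / 40 * (2 * ‖y‖) ^ 2 := by gcongr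
  have e5 : c / 40 * ‖x‖ ^ 2 ≤ c / 40 * (2 * ‖y‖) ^ 2 := by gcongr
  have e6 : 0 ≤ C * η * ‖y‖ ^ 2 := by positivity
  have e7 : 0 ≤ c * ‖y‖ ^ 2 := by positivity
  rw [abs_le]
  constructor
  · nlinarith
  · nlinarith

/-- Along a ray the form is exactly homogeneous of degree two, so being negligible against `‖y‖ ^ 2`
forces it to vanish; a symmetric map is determined by its quadratic form. -/
lemma eq_zero_of_quadratic_isLittleO {V : Type*} [NormedAddCommGroup V] [InnerProductSpace ℝ V]
    {B : V →ₗ[ℝ] V} (hB : B.IsSymmetric)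
    (h : (fun y => ⟪B y, y⟫) =o[𝓝 0] fun y : V => ‖y‖ ^ 2) : B = 0 := by
  refine hB.inner_map_self_eq_zero.1 fun x => ?_
  have hx : ∀ c : ℝ, 0 < c → |⟪B x, x⟫| ≤ c * ‖x‖ ^ 2 := fun c hc => by
    obtain ⟨δ, hδ, H⟩ := exists_forall_norm_lt_of_isLittleO h hc
    obtain ⟨s, hs, hsx⟩ : ∃ s : ℝ, 0 < s ∧ s * ‖x‖ < δ :=
      ⟨δ / (‖x‖ + 1), by positivity, by
        rw [div_mul_eq_mul_div, div_lt_iff₀ (by positivity)]; nlinarith [norm_nonneg x]⟩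
    have := H (s • x) (by rwa [norm_smul, Real.norm_of_nonneg hs.le])
    rw [map_smul, real_inner_smul_left, real_inner_smul_right, norm_smul,
      Real.norm_of_nonneg hs.le, ← mul_assoc, abs_mul, abs_of_pos (by positivity : 0 < s * s)] at this
    have h2 : 0 < s * s := by positivity
    nlinarith
  by_contra hne
  have hpos : 0 < |⟪B x, x⟫| := abs_pos.2 hne
  have := hx (|⟪B x, x⟫| / (2 * (‖x‖ ^ 2 + 1))) (by positivity)
  rw [div_mul_eq_mul_div, le_div_iff₀ (by positivity)] at this
  nlinarith [sq_nonneg ‖x‖]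

lemma LinearMap.IsSymmetric.eq_of_isLittleO {V : Type*} [NormedAddCommGroup V]
    [InnerProductSpace ℝ V] {f : V → ℝ} {A B : V →ₗ[ℝ] V}
    (hA : A.IsSymmetric) (hB : B.IsSymmetric)
    (hfA : (fun y => f y - ⟪A y, y⟫ / 2) =o[𝓝 0] fun y : V => ‖y‖ ^ 2)
    (hfB : (fun y => f y - ⟪B y, y⟫ / 2) =o[𝓝 0] fun y : V => ‖y‖ ^ 2) : A = B := by
  refine sub_eq_zero.1 (eq_zero_of_quadratic_isLittleO (hA.sub hB) ?_)
  have := (hfB.sub hfA).const_mul_left 2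
  refine this.congr_left fun y => ?_
  simp only [LinearMap.sub_apply, inner_sub_left]; ring

end QuadraticExpansion

/-- `M` is nonporous in `S` at `x`: near `x`, every point `y` of `S` has a point of `M` at a distance
that is small compared with the distance from `y` to `x`. -/
def NonporousAt {X : Type*} [PseudoMetricSpace X] (M S : Set X) (x : X) : Prop :=
  ∀ ε : ℝ, 0 < ε → ∃ δ > 0, ∀ y ∈ S, dist y x < δ → ∃ m ∈ M, dist m y ≤ ε * dist y x

/-! ### Normals, boundary functions and curvature of convex sets -/

section Euclidean

variable {E : Type*} [NormedAddCommGroup E] [InnerProductSpace ℝ E]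

lemma IsOuterUnitNormal.anti {P Q : Set E} (h : P ⊆ Q) {x N : E} (hN : IsOuterUnitNormal Q x N) :
    IsOuterUnitNormal P x N :=
  ⟨hN.1, fun z hz => hN.2 z (h hz)⟩

lemma isOuterUnitNormal_of_inner_le {L : Set E} {u : E} (hu : u ≠ 0) (h : ∀ z ∈ L, ⟪z, u⟫ ≤ 0) :
    IsOuterUnitNormal L 0 (‖u‖⁻¹ • u) := by
  refine ⟨by rw [norm_smul, norm_inv, norm_norm, inv_mul_cancel₀ (norm_ne_zero_iff.2 hu)],
    fun z hz => ?_⟩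
  rw [sub_zero, real_inner_smul_right]
  exact mul_nonpos_of_nonneg_of_nonpos (by positivity) (h z hz)

lemma gaussKroneckerCurvature_eq_zero_of_not_exists {L : Set E} {x : E}
    (h : ∀ k, ¬ HasGaussKroneckerCurvature L x k) : gaussKroneckerCurvature L x = 0 := by
  rw [gaussKroneckerCurvature, dif_neg (by simpa using h)]

lemma gaussKroneckerCurvature_eq_zero_of_forall {L : Set E} {x : E}
    (h : ∀ k, HasGaussKroneckerCurvature L x k → k = 0) : gaussKroneckerCurvature L x = 0 := by
  rw [gaussKroneckerCurvature]
  split_ifs with hk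
  · exact h _ hk.choose_spec
  · rfl

/-- Both `u` and `-u` normalize to outer normals; uniqueness identifies them, which forces `N = 0`.
-/
lemma not_unique_isOuterUnitNormal {L : Set E} {u N : E} (hu : u ≠ 0) (h : ∀ z ∈ L, ⟪z, u⟫ = 0)
    (hN : ∀ N', IsOuterUnitNormal L 0 N' → N' = N) : False := by
  have h1 := hN _ (isOuterUnitNormal_of_inner_le hu fun z hz => (h z hz).le)
  have h2 := hN _ (isOuterUnitNormal_of_inner_le (neg_ne_zero.2 hu) fun z hz => by
    rw [inner_neg_right, h z hz, neg_zero])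
  rw [norm_neg, smul_neg, h1] at h2
  have h3 : N = 0 := by
    have h4 : (2 : ℝ) • N = 0 := by rw [two_smul]; nth_rewrite 1 [← h2]; exact neg_add_cancel N
    simpa using h4
  rw [h3] at h1
  exact (smul_ne_zero (inv_ne_zero (norm_ne_zero_iff.2 hu)) hu) h1

/-- A set with two opposite outer normals has vanishing curvature. -/
lemma gaussKroneckerCurvature_eq_zero_of_inner_eq_zero {L : Set E} {u : E} (hu : u ≠ 0)
    (h : ∀ z ∈ L, ⟪z, u⟫ = 0) : gaussKroneckerCurvature L 0 = 0 := by
  refine gaussKroneckerCurvature_eq_zero_of_not_exists fun k => ?_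
  rintro ⟨N, -, hN, -⟩
  exact not_unique_isOuterUnitNormal hu h hN

/-- The projection of a vector onto the hyperplane orthogonal to `N`. -/
noncomputable def horizontal (N x : E) : (ℝ ∙ N)ᗮ := (ℝ ∙ N)ᗮ.orthogonalProjectionOnto x

lemma coe_horizontal {N : E} (hN : ‖N‖ = 1) (x : E) :
    (horizontal N x : E) = x - ⟪x, N⟫ • N := by
  rw [horizontal, Submodule.coe_orthogonalProjectionOnto_apply,
    Submodule.starProjection_orthogonal_val, Submodule.starProjection_singleton, hN,
    real_inner_comm]
  simp

lemma norm_horizontal_sub_le (N x y : E) : ‖horizontal N x - horizontal N y‖ ≤ ‖x - y‖ := by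
  rw [horizontal, horizontal, ← map_sub]
  exact Submodule.norm_orthogonalProjectionOnto_apply_le _ _

lemma horizontal_sub_smul (N : E) (y : (ℝ ∙ N)ᗮ) (t : ℝ) :
    horizontal N ((y : E) - t • N) = y := by
  have h : (ℝ ∙ N)ᗮ.orthogonalProjectionOnto N = 0 := by
    apply Submodule.orthogonalProjectionOnto_apply_of_mem_orthogonal
    simp
  rw [horizontal, map_sub, map_smul, h, smul_zero, sub_zero]
  exact Submodule.orthogonalProjectionOnto_mem_subspace_eq_self y

lemma inner_coe_orthogonal (N : E) (y : (ℝ ∙ N)ᗮ) : ⟪(y : E), N⟫ = 0 := by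
  rw [real_inner_comm]; exact Submodule.mem_orthogonal_singleton_iff_inner_right.1 y.2

lemma inner_coe_sub_smul {N : E} (hN : ‖N‖ = 1) (y : (ℝ ∙ N)ᗮ) (t : ℝ) :
    ⟪(y : E) - t • N, N⟫ = -t := by
  rw [inner_sub_left, inner_coe_orthogonal, real_inner_smul_left, real_inner_self_eq_norm_sq, hN]
  ring

/-- `Q` is near the origin the region above the graph of its boundary function in direction `N`:
it is closed and convex, contains the origin and a ball centered at `-s N`, and has normal `N`. -/
structure IsGraphAt (Q : Set E) (N : E) (s ρ : ℝ) : Prop where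
  closed : IsClosed Q
  convex : Convex ℝ Q
  zero_mem : (0 : E) ∈ Q
  normal : IsOuterUnitNormal Q 0 N
  pos : 0 < ρ
  height_pos : 0 < s
  ball_subset : Metric.ball (-(s • N)) ρ ⊆ Q

namespace IsGraphAt

variable {Q : Set E} {N : E} {s ρ : ℝ}

lemma height_nonneg (h : IsGraphAt Q N s ρ) {y : (ℝ ∙ N)ᗮ} {t : ℝ} (ht : (y : E) - t • N ∈ Q) : 0 ≤ t := by
  have := h.normal.2 _ ht
  rw [sub_zero, inner_coe_sub_smul h.normal.1] at this
  linarith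

lemma bddBelow (h : IsGraphAt Q N s ρ) (y : (ℝ ∙ N)ᗮ) : BddBelow {t : ℝ | 0 + (y : E) - t • N ∈ Q} :=
  ⟨0, fun t ht => h.height_nonneg (by simpa using ht)⟩

lemma boundaryFunction_le (h : IsGraphAt Q N s ρ) {y : (ℝ ∙ N)ᗮ} {t : ℝ} (ht : (y : E) - t • N ∈ Q) :
    boundaryFunction Q 0 N y ≤ t :=
  csInf_le (h.bddBelow y) (by simpa using ht)

lemma mem_interior (h : IsGraphAt Q N s ρ) {y : (ℝ ∙ N)ᗮ} (hy : ‖y‖ < ρ) : (y : E) - s • N ∈ interior Q :=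
  interior_maximal h.ball_subset Metric.isOpen_ball (by
    rw [mem_ball_iff_norm]; simpa using hy)

lemma sub_boundaryFunction_mem (h : IsGraphAt Q N s ρ) {y : (ℝ ∙ N)ᗮ} (hy : ‖y‖ < ρ) :
    (y : E) - boundaryFunction Q 0 N y • N ∈ Q := by
  have hcl : IsClosed {t : ℝ | 0 + (y : E) - t • N ∈ Q} :=
    h.closed.preimage (by fun_prop)
  have := hcl.csInf_mem ⟨s, by simpa using interior_subset (h.mem_interior hy)⟩ (h.bddBelow y)
  have h2 : 0 + (y : E) - boundaryFunction Q 0 N y • N ∈ Q := this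
  rwa [zero_add] at h2

lemma boundaryFunction_nonneg (h : IsGraphAt Q N s ρ) {y : (ℝ ∙ N)ᗮ} (hy : ‖y‖ < ρ) : 0 ≤ boundaryFunction Q 0 N y :=
  h.height_nonneg (h.sub_boundaryFunction_mem hy)

/-- The point is on the open segment from a point of `Q` to the interior point at height `s`. -/
lemma sub_smul_mem_interior (h : IsGraphAt Q N s ρ) {y : (ℝ ∙ N)ᗮ} (hy : ‖y‖ < ρ) {t : ℝ}
    (h1 : boundaryFunction Q 0 N y < t) (h2 : t ≤ s) : (y : E) - t • N ∈ interior Q := by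
  rcases h2.eq_or_lt with rfl | h2
  · exact h.mem_interior hy
  refine h.convex.openSegment_self_interior_subset_interior (h.sub_boundaryFunction_mem hy)
    (h.mem_interior hy) ?_
  set b := boundaryFunction Q 0 N y
  refine ⟨(s - t) / (s - b), (t - b) / (s - b), by apply div_pos <;> linarith,
    by apply div_pos <;> linarith, ?_, ?_⟩
  · have : s - b ≠ 0 := by linarith
    field_simp; ring
  · have hsb : s - b ≠ 0 := by linarith
    have e1 : (s - t) / (s - b) = 1 - (t - b) / (s - b) := by field_simp; ring
    have e2 : t = (1 - (t - b) / (s - b)) * b + (t - b) / (s - b) * s := by field_simp; ring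
    rw [e1]
    conv_rhs => rw [e2]
    module

/-- The bound `t ≤ s` excludes the far side of the boundary: from the graph up to height `s` the
vertical line is interior to `Q`. -/
lemma eq_boundaryFunction_of_mem_frontier (h : IsGraphAt Q N s ρ) {y : (ℝ ∙ N)ᗮ} (hy : ‖y‖ < ρ) {t : ℝ}
    (ht : (y : E) - t • N ∈ frontier Q) (hts : t ≤ s) : boundaryFunction Q 0 N y = t := by
  rw [h.closed.frontier_eq] at ht
  by_contra hne
  exact ht.2 (h.sub_smul_mem_interior hy (lt_of_le_of_ne (h.boundaryFunction_le ht.1) hne) hts)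

lemma sub_boundaryFunction_mem_frontier (h : IsGraphAt Q N s ρ) {y : (ℝ ∙ N)ᗮ} (hy : ‖y‖ < ρ) :
    (y : E) - boundaryFunction Q 0 N y • N ∈ frontier Q := by
  rw [h.closed.frontier_eq]
  refine ⟨h.sub_boundaryFunction_mem hy, fun hint => ?_⟩
  set b := boundaryFunction Q 0 N y
  have hcont : ContinuousAt (fun t : ℝ => (y : E) - t • N) b := by fun_prop
  have := hcont.preimage_mem_nhds (mem_interior_iff_mem_nhds.1 hint)
  obtain ⟨δ, hδ, hb⟩ := Metric.mem_nhds_iff.1 this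
  have h1 : b - δ / 2 ∈ Metric.ball b δ := by
    rw [Metric.mem_ball, Real.dist_eq, sub_sub_cancel_left, abs_neg, abs_of_pos (by positivity)]
    linarith
  have := h.boundaryFunction_le (hb h1)
  linarith

lemma convexOn (h : IsGraphAt Q N s ρ) : ConvexOn ℝ (Metric.ball 0 ρ) (boundaryFunction Q 0 N) := by
  refine ⟨convex_ball _ _, fun y hy z hz a b ha hb hab => ?_⟩
  rw [mem_ball_zero_iff] at hy hz
  refine h.boundaryFunction_le ?_
  have := h.convex (h.sub_boundaryFunction_mem hy) (h.sub_boundaryFunction_mem hz) ha hb hab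
  convert this using 1
  simp only [Submodule.coe_add, Submodule.coe_smul, smul_eq_mul]
  module

/-- If `P ∩ ∂Q` is nonporous in `∂Q` at the origin, then its points lie densely over the tangent
hyperplane. -/
lemma exists_touching (h : IsGraphAt Q N s ρ) {P : Set E} (hNP : NonporousAt (P ∩ frontier Q) (frontier Q) 0) {δ₀ : ℝ}
    (hδ₀ : 0 < δ₀) (hf : ∀ y : (ℝ ∙ N)ᗮ, ‖y‖ < δ₀ → boundaryFunction Q 0 N y ≤ ‖y‖) {ε : ℝ}
    (hε : 0 < ε) : ∃ δ > 0, ∀ y : (ℝ ∙ N)ᗮ, ‖y‖ < δ →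
      ∃ z : (ℝ ∙ N)ᗮ, ‖z - y‖ ≤ ε * ‖y‖ ∧ (z : E) - boundaryFunction Q 0 N z • N ∈ P := by
  obtain ⟨δ, hδ, H⟩ := hNP (ε / 2) (by positivity)
  have hρ := h.pos
  have hs := h.height_pos
  have hN := h.normal.1
  refine ⟨min (min δ₀ (δ / 2)) (min (ρ / (2 + ε)) (s / (2 + ε))), by positivity, fun y hy => ?_⟩
  simp only [lt_min_iff] at hy
  obtain ⟨⟨hy0, hyδ⟩, hyρ, hys⟩ := hy
  rw [lt_div_iff₀ (by positivity)] at hyρ hys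
  have hyn := norm_nonneg y
  have hεy : 0 ≤ ε * ‖y‖ := by positivity
  have hyρ' : ‖y‖ < ρ := by nlinarith
  set x := (y : E) - boundaryFunction Q 0 N y • N with hx
  have hxn : ‖x‖ ≤ 2 * ‖y‖ := by
    refine (norm_sub_le _ _).trans ?_
    rw [norm_smul, hN, mul_one, Real.norm_of_nonneg (h.boundaryFunction_nonneg hyρ')]
    have := hf y hy0
    have h2 : ‖(y : E)‖ = ‖y‖ := rfl
    linarith
  obtain ⟨m, ⟨hmP, hmQ⟩, hmx⟩ := H x (h.sub_boundaryFunction_mem_frontier hyρ')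
    (by rw [dist_zero_right]; linarith)
  rw [dist_zero_right, dist_eq_norm] at hmx
  have hmx' : ‖m - x‖ ≤ ε * ‖y‖ := hmx.trans (by nlinarith)
  have hm : ‖m‖ ≤ (2 + ε) * ‖y‖ := by
    have : ‖m‖ ≤ ‖m - x‖ + ‖x‖ := by simpa using norm_add_le (m - x) x
    linarith
  have hmz : m = (horizontal N m : E) - (-⟪m, N⟫) • N := by
    rw [coe_horizontal hN]; module
  have hzn : ‖horizontal N m‖ < ρ := by
    have := norm_horizontal_sub_le N m 0
    rw [sub_zero, horizontal, horizontal, map_zero, sub_zero] at this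
    rw [horizontal]
    linarith
  -- The height of `m` is at most `‖m‖`, which is below `s` for small `y`; so `m` lies on the graph
  -- and not on the far side of the boundary.
  have hts : -⟪m, N⟫ ≤ s := by
    have := abs_le.1 (abs_real_inner_le_norm m N)
    rw [hN] at this
    linarith
  refine ⟨horizontal N m, ?_, ?_⟩
  · have := norm_horizontal_sub_le N m x
    rw [hx, horizontal_sub_smul] at this
    exact this.trans hmx'
  · rw [h.eq_boundaryFunction_of_mem_frontier hzn (t := -⟪m, N⟫) (hmz ▸ hmQ) hts, ← hmz]
    exact hmP

end IsGraphAt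

lemma exists_le_norm_of_isLittleO {V : Type*} [NormedAddCommGroup V] [InnerProductSpace ℝ V]
    [FiniteDimensional ℝ V] {f : V → ℝ} {A : V →ₗ[ℝ] V}
    (hf : (fun y => f y - ⟪A y, y⟫ / 2) =o[𝓝 0] fun y : V => ‖y‖ ^ 2) :
    ∃ C > 0, ∃ δ > 0, ∀ y, ‖y‖ < δ → |f y| ≤ C * ‖y‖ ^ 2 := by
  obtain ⟨C, hC, -, hC'⟩ := exists_abs_quadratic_sub_le A
  obtain ⟨δ, hδ, H⟩ := exists_forall_norm_lt_of_isLittleO hf one_pos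
  refine ⟨C + 1, by positivity, δ, hδ, fun y hy => ?_⟩
  have h1 := H y hy
  have h2 := hC' y
  have h3 := abs_add_le (f y - ⟪A y, y⟫ / 2) (⟪A y, y⟫ / 2)
  rw [sub_add_cancel] at h3
  linarith

lemma exists_le_norm_of_le_sq {V : Type*} [NormedAddCommGroup V] {f : V → ℝ} {C δ : ℝ}
    (hC : 0 < C) (hδ : 0 < δ) (h : ∀ y, ‖y‖ < δ → |f y| ≤ C * ‖y‖ ^ 2) :
    ∃ δ' > 0, ∀ y, ‖y‖ < δ' → f y ≤ ‖y‖ := by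
  refine ⟨min δ (1 / C), by positivity, fun y hy => ?_⟩
  rw [lt_min_iff, lt_div_iff₀ hC] at hy
  have h1 := (abs_le.1 (h y hy.1)).2
  nlinarith [norm_nonneg y]

/-- Makes the value chosen in `gaussKroneckerCurvature` independent of the choice. -/
lemma HasGaussKroneckerCurvature.unique {L : Set E} {x : E} {k k' : ℝ}
    (h : HasGaussKroneckerCurvature L x k) (h' : HasGaussKroneckerCurvature L x k') : k = k' := by
  obtain ⟨N, hN, -, A, hA, hfA, rfl⟩ := h
  obtain ⟨N', -, huniq, B, hB, hfB, rfl⟩ := h'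
  obtain rfl := huniq N hN
  rw [hA.eq_of_isLittleO hB hfA hfB]

lemma HasGaussKroneckerCurvature.gaussKroneckerCurvature_eq {L : Set E} {x : E} {k : ℝ}
    (h : HasGaussKroneckerCurvature L x k) : gaussKroneckerCurvature L x = k := by
  have hex : ∃ k, HasGaussKroneckerCurvature L x k := ⟨k, h⟩
  rw [gaussKroneckerCurvature, dif_pos hex]
  exact hex.choose_spec.unique h

variable [FiniteDimensional ℝ E]

/-- A convex set without interior does not span affinely; since it contains the origin, its linear
span is proper and has a nonzero orthogonal vector. -/
lemma Convex.exists_inner_eq_zero_of_interior_eq_empty {L : Set E} (hL : Convex ℝ L)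
    (h0 : (0 : E) ∈ L) (hint : interior L = ∅) : ∃ u : E, u ≠ 0 ∧ ∀ z ∈ L, ⟪z, u⟫ = 0 := by
  have h1 : affineSpan ℝ L ≠ ⊤ := fun h => by
    simpa [hint] using hL.interior_nonempty_iff_affineSpan_eq_top.2 h
  rw [Ne, AffineSubspace.affineSpan_eq_top_iff_vectorSpan_eq_top_of_nonempty ℝ E E ⟨0, h0⟩,
    vectorSpan_eq_span_vsub_set_right ℝ h0] at h1
  simp only [vsub_eq_sub, sub_zero, image_id'] at h1
  obtain ⟨u, hu, hu0⟩ := Submodule.exists_mem_ne_zero_of_ne_bot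
    (mt Submodule.orthogonal_eq_bot_iff.1 h1)
  exact ⟨u, hu0, fun z hz => hu z (Submodule.subset_span hz)⟩

lemma Convex.gaussKroneckerCurvature_eq_zero {L : Set E} (hL : Convex ℝ L)
    (h0 : (0 : E) ∈ L) (hint : interior L = ∅) : gaussKroneckerCurvature L 0 = 0 := by
  obtain ⟨u, hu, h⟩ := hL.exists_inner_eq_zero_of_interior_eq_empty h0 hint
  exact gaussKroneckerCurvature_eq_zero_of_inner_eq_zero hu h

lemma Convex.exists_inner_lt_of_notMem_interior {L : Set E} (hL : Convex ℝ L) {x : E}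
    (hx : x ∉ interior L) (hint : (interior L).Nonempty) :
    ∃ u : E, u ≠ 0 ∧ ∀ z ∈ L, ⟪z, u⟫ ≤ ⟪x, u⟫ := by
  obtain ⟨φ, hφ⟩ := geometric_hahn_banach_open_point hL.interior isOpen_interior hx
  refine ⟨(InnerProductSpace.toDual ℝ E).symm φ, fun h0 => ?_, fun z hz => ?_⟩
  · obtain ⟨z, hz⟩ := hint
    have h1 := hφ z hz
    rw [(LinearIsometryEquiv.map_eq_zero_iff _).1 h0] at h1
    simp at h1
  · rw [real_inner_comm, InnerProductSpace.toDual_symm_apply, real_inner_comm,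
      InnerProductSpace.toDual_symm_apply]
    have hz' : z ∈ closure (interior L) := by
      rw [hL.closure_interior_eq_closure_of_nonempty_interior hint]; exact subset_closure hz
    exact closure_minimal (fun a ha => (hφ a ha).le)
      (isClosed_le φ.continuous continuous_const) hz'

lemma Convex.exists_isOuterUnitNormal {L : Set E} (hL : Convex ℝ L) (h0 : (0 : E) ∈ L)
    (hint : (0 : E) ∉ interior L) : ∃ N, IsOuterUnitNormal L 0 N := by
  rcases (interior L).eq_empty_or_nonempty with he | hne
  · obtain ⟨u, hu, h⟩ := hL.exists_inner_eq_zero_of_interior_eq_empty h0 he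
    exact ⟨_, isOuterUnitNormal_of_inner_le hu fun z hz => (h z hz).le⟩
  · obtain ⟨u, hu, h⟩ := hL.exists_inner_lt_of_notMem_interior hint hne
    exact ⟨_, isOuterUnitNormal_of_inner_le hu fun z hz => by simpa using h z hz⟩

/-- A convex set with exactly one outer unit normal `N` at the origin contains in its interior points
of the ray in direction `-N`. -/
lemma Convex.exists_isGraphAt {L : Set E} (hLc : IsClosed L) (hL : Convex ℝ L) (h0 : (0 : E) ∈ L)
    {N : E} (hN : IsOuterUnitNormal L 0 N) (huniq : ∀ N', IsOuterUnitNormal L 0 N' → N' = N) :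
    ∃ s ρ : ℝ, IsGraphAt L N s ρ := by
  have hne : (interior L).Nonempty := by
    by_contra he
    obtain ⟨u, hu, h⟩ := hL.exists_inner_eq_zero_of_interior_eq_empty h0
      (not_nonempty_iff_eq_empty.1 he)
    exact not_unique_isOuterUnitNormal hu h huniq
  suffices ∃ s : ℝ, 0 < s ∧ -(s • N) ∈ interior L by
    obtain ⟨s, hs, hsL⟩ := this
    obtain ⟨ρ, hρ, hb⟩ := Metric.mem_nhds_iff.1 (mem_interior_iff_mem_nhds.1 hsL)
    exact ⟨s, ρ, hLc, hL, h0, hN, hρ, hs, hb⟩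
  by_contra! hcon
  -- If the ray in direction `-N` missed the interior, a separating functional would represent an
  -- outer normal, hence a positive multiple of `N`; but it is nonnegative on `-N`.
  set R : Set E := (fun s : ℝ => -(s • N)) '' Ioi 0 with hR
  have hRconv : Convex ℝ R := by
    have : (fun s : ℝ => -(s • N)) = (-(LinearMap.toSpanSingleton ℝ E N) : ℝ →ₗ[ℝ] E) := by
      ext; simp
    rw [hR, this]
    exact (convex_Ioi 0).linear_image _
  have hdisj : Disjoint (interior L) R := by
    rw [Set.disjoint_left]
    rintro _ hx ⟨s, hs, rfl⟩
    exact hcon s hs hx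
  obtain ⟨φ, u, hφL, hφR⟩ := geometric_hahn_banach_open hL.interior isOpen_interior hRconv hdisj
  have hφ_L : ∀ z ∈ L, φ z ≤ u := fun z hz => by
    have hz' : z ∈ closure (interior L) := by
      rw [hL.closure_interior_eq_closure_of_nonempty_interior hne]; exact subset_closure hz
    exact closure_minimal (fun a ha => (hφL a ha).le)
      (isClosed_le φ.continuous continuous_const) hz'
  have hu0 : 0 ≤ u := by simpa using hφ_L 0 h0
  have hφN : ∀ s : ℝ, 0 < s → u ≤ s * (-φ N) := fun s hs => by
    have := hφR _ ⟨s, hs, rfl⟩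
    simpa using this
  -- Let the parameter of the ray tend to zero.
  have hu : u = 0 := by
    refine le_antisymm (le_of_forall_pos_le_add fun c hc => ?_) hu0
    rw [zero_add]
    refine (hφN (c / (|φ N| + 1)) (by positivity)).trans ?_
    rw [div_mul_eq_mul_div, div_le_iff₀ (by positivity)]
    nlinarith [neg_abs_le (φ N), le_abs_self (φ N)]
  set e := (InnerProductSpace.toDual ℝ E).symm φ with he
  have hφe : ∀ z, φ z = ⟪z, e⟫ := fun z => by
    rw [real_inner_comm, InnerProductSpace.toDual_symm_apply]
  have he0 : e ≠ 0 := fun h0 => by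
    obtain ⟨z, hz⟩ := hne
    have h1 := hφL z hz
    rw [hφe, h0, inner_zero_right] at h1
    linarith
  have heN := huniq _ (isOuterUnitNormal_of_inner_le he0 fun z hz => by
    rw [← hφe]; exact (hφ_L z hz).trans hu.le)
  have h1 := hφN 1 one_pos
  rw [hφe, ← heN, real_inner_smul_left, real_inner_self_eq_norm_sq] at h1
  have h2 : 0 < ‖e‖ := norm_pos_iff.2 he0
  have h3 : 0 < ‖e‖⁻¹ * ‖e‖ ^ 2 := by positivity
  linarith

end Euclidean

/-! ### Curvature of nested and of covering convex sets -/

section Nested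

variable {E : Type*} [NormedAddCommGroup E] [InnerProductSpace ℝ E] {P Q : Set E}

/-- A point of `P` on the graph of the lower function bounds the upper function from above, so the
two agree over it. -/
lemma IsGraphAt.touchDensely {N : E} {s ρ : ℝ} (hP : IsGraphAt P N s ρ)
    (hPQ : ∀ y : (ℝ ∙ N)ᗮ, ‖y‖ < ρ → boundaryFunction Q 0 N y ≤ boundaryFunction P 0 N y)
    (H : ∀ ε : ℝ, 0 < ε → ∃ δ > 0, ∀ y : (ℝ ∙ N)ᗮ, ‖y‖ < δ →
      ∃ z : (ℝ ∙ N)ᗮ, ‖z - y‖ ≤ ε * ‖y‖ ∧ (z : E) - boundaryFunction Q 0 N z • N ∈ P) :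
    TouchDensely (boundaryFunction Q 0 N) (boundaryFunction P 0 N) := by
  intro ε hε
  obtain ⟨δ, hδ, h⟩ := H ε hε
  have hρ := hP.pos
  refine ⟨min δ (ρ / (1 + ε)), by positivity, fun y hy => ?_⟩
  rw [lt_min_iff, lt_div_iff₀ (by positivity)] at hy
  obtain ⟨z, hz, hzP⟩ := h y hy.1
  refine ⟨z, hz, le_antisymm (hP.boundaryFunction_le hzP) (hPQ z ?_)⟩
  have : ‖z‖ ≤ ‖z - y‖ + ‖y‖ := by simpa using norm_add_le (z - y) y
  nlinarith

lemma IsGraphAt.mono {N : E} {s ρ : ℝ} (hP : IsGraphAt P N s ρ) (hPQ : P ⊆ Q) (hQc : IsClosed Q)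
    (hQ : Convex ℝ Q) (hN : IsOuterUnitNormal Q 0 N) : IsGraphAt Q N s ρ :=
  ⟨hQc, hQ, hPQ hP.zero_mem, hN, hP.pos, hP.height_pos, hP.ball_subset.trans hPQ⟩

lemma IsGraphAt.boundaryFunction_anti {N : E} {s ρ : ℝ} (hP : IsGraphAt P N s ρ)
    (hQ : IsGraphAt Q N s ρ) (hPQ : P ⊆ Q) {y : (ℝ ∙ N)ᗮ} (hy : ‖y‖ < ρ) :
    boundaryFunction Q 0 N y ≤ boundaryFunction P 0 N y :=
  hQ.boundaryFunction_le (hPQ (hP.sub_boundaryFunction_mem hy))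

/-- The curvature of the larger of two nested sets with densely touching boundaries is inherited
from the smaller one. -/
lemma HasGaussKroneckerCurvature.of_subset [FiniteDimensional ℝ E] (hQc : IsClosed Q) (hQ : Convex ℝ Q)
    (hPc : IsClosed P) (hP : Convex ℝ P) (hPQ : P ⊆ Q) (h0 : (0 : E) ∈ P) (h0Q : (0 : E) ∈ frontier Q)
    (hNP : NonporousAt (P ∩ frontier Q) (frontier Q) 0) {k : ℝ}
    (hk : HasGaussKroneckerCurvature P 0 k) : HasGaussKroneckerCurvature Q 0 k := by
  obtain ⟨N, hN, huniq, A, hA, hfA, rfl⟩ := hk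
  obtain ⟨N', hN'⟩ := hQ.exists_isOuterUnitNormal (hPQ h0) (by
    rw [hQc.frontier_eq] at h0Q; exact h0Q.2)
  obtain rfl := huniq N' (hN'.anti hPQ)
  refine ⟨N', hN', fun N hN => huniq N (hN.anti hPQ), A, hA, ?_, rfl⟩
  obtain ⟨s, ρ, hgP⟩ := hP.exists_isGraphAt hPc h0 hN huniq
  have hgQ := hgP.mono hPQ hQc hQ hN'
  have hle : ∀ y : (ℝ ∙ N')ᗮ, ‖y‖ < ρ → boundaryFunction Q 0 N' y ≤ boundaryFunction P 0 N' y :=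
    fun y hy => hgP.boundaryFunction_anti hgQ hPQ hy
  obtain ⟨C, hC, δ, hδ, hCδ⟩ := exists_le_norm_of_isLittleO hfA
  obtain ⟨δ', hδ', hb⟩ := exists_le_norm_of_le_sq hC hδ hCδ
  refine hgQ.convexOn.isLittleO_of_touchDensely_of_ge hgP.pos hle
    (hgP.touchDensely hle fun ε hε => ?_) hfA
  refine hgQ.exists_touching hNP (δ₀ := min δ' ρ) (lt_min hδ' hgP.pos) (fun y hy => ?_) hε
  rw [lt_min_iff] at hy
  exact (hle y hy.2).trans (hb y hy.1)

lemma eq_or_eq_neg_of_horizontal_eq_zero {N N' : E} (hN : ‖N‖ = 1) (hN' : ‖N'‖ = 1)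
    (h : horizontal N N' = 0) : N' = N ∨ N' = -N := by
  have h1 := coe_horizontal hN N'
  rw [h, Submodule.coe_zero, eq_comm, sub_eq_zero] at h1
  have h2 : |⟪N', N⟫| = 1 := by
    have := congrArg norm h1
    rwa [norm_smul, hN, hN', mul_one, Real.norm_eq_abs, eq_comm] at this
  rcases eq_or_eq_neg_of_abs_eq h2 with h3 | h3 <;> rw [h3] at h1
  · left; simpa using h1
  · right; simpa using h1

/-- Outer normals of the smaller set are normal to the tangent hyperplane of the larger one. -/
lemma horizontal_eq_zero_of_touching {N N' : E} (hN : ‖N‖ = 1) (hN' : IsOuterUnitNormal P 0 N')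
    {f : (ℝ ∙ N)ᗮ → ℝ} {C δ : ℝ} (hC : 0 < C) (hδ : 0 < δ) (hf : ∀ y, ‖y‖ < δ → |f y| ≤ C * ‖y‖ ^ 2)
    (H : ∀ ε : ℝ, 0 < ε → ∃ δ > 0, ∀ y : (ℝ ∙ N)ᗮ, ‖y‖ < δ →
      ∃ z : (ℝ ∙ N)ᗮ, ‖z - y‖ ≤ ε * ‖y‖ ∧ (z : E) - f z • N ∈ P) :
    horizontal N N' = 0 := by
  by_contra hne
  set v := horizontal N N' with hv
  have hvpos : 0 < ‖v‖ := norm_pos_iff.2 hne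
  obtain ⟨δ₁, hδ₁, h⟩ := H (1 / 2) (by positivity)
  -- Test the normal over `r • v`: a contact point near there gains at least `r * ‖v‖ ^ 2 / 2` in
  -- direction `v`, while its height is quadratic in `r`. The last condition makes the height too
  -- small to compensate.
  obtain ⟨r, hr, hr1, hr2, hr3⟩ : ∃ r : ℝ, 0 < r ∧ r * ‖v‖ < δ₁ ∧ 2 * (r * ‖v‖) < δ ∧
      4 * C * (r * ‖v‖) < 1 / 4 * ‖v‖ := by
    refine ⟨min (min (δ₁ / 2) (δ / 3)) (‖v‖ / (32 * C)) / ‖v‖, by positivity, ?_, ?_, ?_⟩ <;>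
      rw [div_mul_cancel₀ _ hvpos.ne']
    · exact ((min_le_left _ _).trans (min_le_left _ _)).trans_lt (by linarith)
    · have := (min_le_left (min (δ₁ / 2) (δ / 3)) (‖v‖ / (32 * C))).trans (min_le_right _ _)
      linarith
    · calc 4 * C * _ ≤ 4 * C * (‖v‖ / (32 * C)) := by gcongr; exact min_le_right _ _
        _ = ‖v‖ / 8 := by field_simp; norm_num
        _ < _ := by linarith
  have hrv : ‖r • v‖ = r * ‖v‖ := by rw [norm_smul, Real.norm_of_nonneg hr.le]
  obtain ⟨z, hz, hzP⟩ := h (r • v) (hrv ▸ hr1)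
  have h1 := hN'.2 _ hzP
  have hNz : ⟪(z : E), N'⟫ = ⟪z, v⟫ := by
    have e1 : ⟪z, v⟫ = ⟪(z : E), (v : E)⟫ := rfl
    rw [e1, hv, coe_horizontal hN, inner_sub_right, real_inner_smul_right, inner_coe_orthogonal,
      mul_zero, sub_zero]
  rw [sub_zero, inner_sub_left, real_inner_smul_left, hNz] at h1
  rw [hrv] at hz
  have hzn : ‖z‖ ≤ 2 * (r * ‖v‖) := by
    have : ‖z‖ ≤ ‖z - r • v‖ + ‖r • v‖ := by simpa using norm_add_le (z - r • v) (r • v)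
    rw [hrv] at this
    nlinarith
  have h2 : ⟪z, v⟫ = r * ‖v‖ ^ 2 + ⟪z - r • v, v⟫ := by
    rw [inner_sub_left, real_inner_smul_left, real_inner_self_eq_norm_sq]; ring
  have h3 : |⟪z - r • v, v⟫| ≤ 1 / 2 * (r * ‖v‖) * ‖v‖ :=
    (abs_real_inner_le_norm _ _).trans (by gcongr)
  have h4 : |f z * ⟪N, N'⟫| ≤ C * (2 * (r * ‖v‖)) ^ 2 := by
    rw [abs_mul]
    have e1 : |⟪N, N'⟫| ≤ 1 := by
      have := abs_real_inner_le_norm N N'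
      rwa [hN, hN'.1, one_mul] at this
    calc |f z| * |⟪N, N'⟫| ≤ |f z| * 1 := by gcongr
      _ = |f z| := mul_one _
      _ ≤ C * ‖z‖ ^ 2 := hf z (hzn.trans_lt hr2)
      _ ≤ _ := by gcongr
  have h5 := (abs_le.1 h3).1
  have h6 := (abs_le.1 h4).2
  have h7 : 0 < r * ‖v‖ := by positivity
  have h8 : 4 * C * (r * ‖v‖) * (r * ‖v‖) < 1 / 4 * ‖v‖ * (r * ‖v‖) := by gcongr
  nlinarith

lemma nontrivial_orthogonal_singleton [FiniteDimensional ℝ E] (hdim : 2 ≤ Module.finrank ℝ E)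
    (N : E) : Nontrivial (ℝ ∙ N)ᗮ := by
  refine Module.nontrivial_of_finrank_pos (R := ℝ) ?_
  have h1 := Submodule.finrank_add_finrank_orthogonal (ℝ ∙ N)
  have h2 := finrank_span_le_card (R := ℝ) ({N} : Set E)
  simp only [toFinset_singleton, Finset.card_singleton] at h2
  omega

/-- Nested closed convex sets whose boundaries touch densely at the origin have the same generalized
Gauss-Kronecker curvature there. -/
theorem gaussKroneckerCurvature_eq_of_nonporousAt [FiniteDimensional ℝ E] (hdim : 2 ≤ Module.finrank ℝ E)
    (hQc : IsClosed Q) (hQ : Convex ℝ Q) (hPc : IsClosed P) (hP : Convex ℝ P) (hPQ : P ⊆ Q)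
    (h0 : (0 : E) ∈ P) (h0Q : (0 : E) ∈ frontier Q)
    (hNP : NonporousAt (P ∩ frontier Q) (frontier Q) 0) :
    gaussKroneckerCurvature P 0 = gaussKroneckerCurvature Q 0 := by
  by_cases hPk : ∃ k, HasGaussKroneckerCurvature P 0 k
  · obtain ⟨k, hk⟩ := hPk
    rw [hk.gaussKroneckerCurvature_eq,
      (hk.of_subset hQc hQ hPc hP hPQ h0 h0Q hNP).gaussKroneckerCurvature_eq]
  -- Here `P` carries the default value, so a curvature of `Q`, if it exists, has to be shown to
  -- vanish.
  rw [gaussKroneckerCurvature_eq_zero_of_not_exists (by simpa using hPk), eq_comm]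
  refine gaussKroneckerCurvature_eq_zero_of_forall fun k hk => ?_
  obtain ⟨N, hN, huniq, A, hA, hfA, rfl⟩ := hk
  obtain ⟨s, ρ, hgQ⟩ := hQ.exists_isGraphAt hQc (hPQ h0) hN huniq
  obtain ⟨C, hC, δ, hδ, hCδ⟩ := exists_le_norm_of_isLittleO hfA
  obtain ⟨δ', hδ', hb⟩ := exists_le_norm_of_le_sq hC hδ hCδ
  have htouch := fun ε (hε : 0 < ε) => hgQ.exists_touching hNP hδ' hb hε
  have hnorm : ∀ N', IsOuterUnitNormal P 0 N' → N' = N ∨ N' = -N := fun N' hN' =>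
    eq_or_eq_neg_of_horizontal_eq_zero hN.1 hN'.1
      (horizontal_eq_zero_of_touching hN.1 hN' hC hδ hCδ htouch)
  by_cases hneg : IsOuterUnitNormal P 0 (-N)
  -- With both `N` and `-N` normal, `P` lies in the hyperplane `N^⊥`. The boundary function of `Q`
  -- then touches zero densely, and its quadratic part vanishes.
  · have hzero : TouchDensely (fun _ => 0) (boundaryFunction Q 0 N) := by
      intro ε hε
      obtain ⟨δ₁, hδ₁, H⟩ := htouch ε hε
      have hρ := hgQ.pos
      refine ⟨min δ₁ (ρ / (1 + ε)), by positivity, fun y hy => ?_⟩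
      rw [lt_min_iff, lt_div_iff₀ (by positivity)] at hy
      obtain ⟨z, hz, hzP⟩ := H y hy.1
      refine ⟨z, hz, le_antisymm ?_ (hgQ.boundaryFunction_nonneg ?_)⟩
      · have := hneg.2 _ hzP
        rw [sub_zero, inner_neg_right, inner_coe_sub_smul hN.1, neg_neg] at this
        exact this
      · have : ‖z‖ ≤ ‖z - y‖ + ‖y‖ := by simpa using norm_add_le (z - y) y
        nlinarith
    have hA0 : A = 0 := by
      have h1 := (convexOn_const (0 : ℝ) (convex_ball (0 : (ℝ ∙ N)ᗮ)
        ρ)).isLittleO_of_touchDensely_of_ge hgQ.pos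
        (fun y hy => hgQ.boundaryFunction_nonneg hy) hzero hfA
      refine hA.eq_of_isLittleO (f := fun _ => 0) (LinearMap.IsSymmetric.zero) h1 ?_
      simp
    -- On a trivial tangent space the zero map would have determinant `1`.
    have := nontrivial_orthogonal_singleton hdim N
    rw [hA0, LinearMap.det_zero'']
  -- Now `N` is the only normal of `P`, and the expansion of `Q` passes to `P`, which was assumed to
  -- have no curvature.
  · exfalso
    have huniqP : ∀ N', IsOuterUnitNormal P 0 N' → N' = N := fun N' hN' =>
      (hnorm N' hN').resolve_right fun h => hneg (h ▸ hN')
    obtain ⟨s', ρ', hgP⟩ := hP.exists_isGraphAt hPc h0 (hN.anti hPQ) huniqP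
    have hgQ' := hgP.mono hPQ hQc hQ hN
    have hle : ∀ y : (ℝ ∙ N)ᗮ, ‖y‖ < ρ' → boundaryFunction Q 0 N y ≤ boundaryFunction P 0 N y :=
      fun y hy => hgP.boundaryFunction_anti hgQ' hPQ hy
    exact hPk ⟨_, N, hN.anti hPQ, huniqP, A, hA,
      hgP.convexOn.isLittleO_of_touchDensely_of_le hgP.pos hle
        (hgP.touchDensely hle htouch) hfA, rfl⟩

/-- Two closed convex sets that cover a neighborhood of a common boundary point, and their
intersection, have vanishing curvature there. -/
theorem gaussKroneckerCurvature_eq_zero_of_union_mem_nhds [FiniteDimensional ℝ E] (hdim : 2 ≤ Module.finrank ℝ E)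
    (hPc : IsClosed P) (hP : Convex ℝ P) (hQ : Convex ℝ Q) (h0P : (0 : E) ∈ frontier P)
    (h0Q : (0 : E) ∈ Q) (h0Q' : (0 : E) ∉ interior Q) (hPQ : P ∪ Q ∈ 𝓝 (0 : E)) :
    gaussKroneckerCurvature P 0 = 0 ∧ gaussKroneckerCurvature (P ∩ Q) 0 = 0 := by
  rw [hPc.frontier_eq] at h0P
  obtain ⟨N, hN⟩ := hP.exists_isOuterUnitNormal h0P.1 h0P.2
  obtain ⟨N', hN'⟩ := hQ.exists_isOuterUnitNormal h0Q h0Q'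
  obtain ⟨r, hr, hball⟩ := Metric.mem_nhds_iff.1 hPQ
  -- Otherwise `N + N'` has positive inner product with both normals, and a small multiple of it
  -- leaves both sets.
  have hNN : N' = -N := by
    by_contra hne
    have hlt : -1 < ⟪N, N'⟫ := by
      have h1 : -1 ≤ ⟪N, N'⟫ := by
        have := (abs_le.1 (abs_real_inner_le_norm N N')).1
        rwa [hN.1, hN'.1, one_mul] at this
      refine lt_of_le_of_ne h1 fun h => hne ?_
      exact (eq_neg_of_add_eq_zero_right (by
        rw [← norm_eq_zero, ← sq_eq_zero_iff, norm_add_sq_real, hN.1, hN'.1, ← h]; norm_num))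
    have hx : (r / 4) • (N + N') ∈ Metric.ball (0 : E) r := by
      rw [mem_ball_zero_iff, norm_smul, Real.norm_of_nonneg (by positivity)]
      have := norm_add_le N N'
      rw [hN.1, hN'.1] at this
      nlinarith
    rcases hball hx with h | h
    · have := hN.2 _ h
      rw [sub_zero, real_inner_smul_left, inner_add_left, real_inner_self_eq_norm_sq, hN.1,
        real_inner_comm] at this
      nlinarith
    · have := hN'.2 _ h
      rw [sub_zero, real_inner_smul_left, inner_add_left, real_inner_self_eq_norm_sq, hN'.1] at this
      nlinarith
  subst hNN
  have hN0 : N ≠ 0 := norm_ne_zero_iff.1 (by rw [hN.1]; exact one_ne_zero)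
  constructor
  · refine gaussKroneckerCurvature_eq_zero_of_forall fun k hk => ?_
    obtain ⟨N', -, huniq, A, hA, hfA, rfl⟩ := hk
    obtain rfl := huniq N hN
    obtain ⟨s, ρ, hg⟩ := hP.exists_isGraphAt hPc h0P.1 hN huniq
    have hρ := hg.pos
    -- A point at height `t > 0` is strictly on the outer side of the hyperplane supporting `Q`, so
    -- near the origin it must belong to `P`.
    have hf0 : ∀ y : (ℝ ∙ N)ᗮ, ‖y‖ < min ρ (r / 2) → boundaryFunction P 0 N y = 0 := by
      intro y hy
      rw [lt_min_iff] at hy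
      refine le_antisymm (le_of_forall_pos_le_add fun c hc => ?_)
        (hg.boundaryFunction_nonneg hy.1)
      rw [zero_add]
      set t := min c (r / 3)
      have ht : 0 < t := by positivity
      refine (hg.boundaryFunction_le (t := t) ?_).trans (min_le_left _ _)
      have hmem : (y : E) - t • N ∈ Metric.ball (0 : E) r := by
        rw [mem_ball_zero_iff]
        refine (norm_sub_le _ _).trans_lt ?_
        rw [norm_smul, hN.1, Real.norm_of_nonneg ht.le]
        have e1 : ‖(y : E)‖ = ‖y‖ := rfl
        have e2 : t ≤ r / 3 := min_le_right _ _
        linarith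
      refine (hball hmem).resolve_right fun h => ?_
      have := hN'.2 _ h
      rw [sub_zero, inner_neg_right, inner_coe_sub_smul hN.1] at this
      linarith
    have hA0 : A = 0 := by
      refine hA.eq_of_isLittleO (f := fun _ => 0) LinearMap.IsSymmetric.zero ?_ (by simp)
      refine hfA.congr' ?_ EventuallyEq.rfl
      filter_upwards [Metric.ball_mem_nhds (0 : (ℝ ∙ N)ᗮ) (show 0 < min ρ (r / 2) by positivity)]
        with y hy
      rw [hf0 y (by simpa using hy)]
    have := nontrivial_orthogonal_singleton hdim N
    rw [hA0, LinearMap.det_zero'']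
  · refine gaussKroneckerCurvature_eq_zero_of_inner_eq_zero hN0 fun z hz => ?_
    have h1 := hN.2 z hz.1
    have h2 := hN'.2 z hz.2
    rw [sub_zero] at h1 h2
    rw [inner_neg_right] at h2
    linarith

end Nested

/-! ### Density points and nonporosity -/

section Density

lemma NonporousAt.mono {X : Type*} [PseudoMetricSpace X] {M M' S S' : Set X} {x : X}
    (h : NonporousAt M S x) (hM : M ⊆ M') (hS : S' ⊆ S) : NonporousAt M' S' x := fun ε hε => by
  obtain ⟨δ, hδ, H⟩ := h ε hε
  refine ⟨δ, hδ, fun y hy hyx => ?_⟩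
  obtain ⟨m, hm, hmy⟩ := H y (hS hy) hyx
  exact ⟨m, hM hm, hmy⟩

lemma NonporousAt.of_inter {X : Type*} [PseudoMetricSpace X] {M S U : Set X} {x : X}
    (hU : U ∈ 𝓝 x) (h : NonporousAt M (S ∩ U) x) : NonporousAt M S x := fun ε hε => by
  obtain ⟨δ, hδ, H⟩ := h ε hε
  obtain ⟨r, hr, hrU⟩ := Metric.mem_nhds_iff.1 hU
  refine ⟨min δ r, by positivity, fun y hy hyx => ?_⟩
  rw [lt_min_iff] at hyx
  exact H y ⟨hy, hrU hyx.2⟩ hyx.1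

lemma nonporousAt_of_subset {X : Type*} [PseudoMetricSpace X] {M S : Set X} {x : X}
    (h : S ⊆ M) : NonporousAt M S x := fun ε hε =>
  ⟨1, one_pos, fun y hy _ => ⟨y, h hy, by rw [dist_self]; positivity⟩⟩

variable {F : Type*} [NormedAddCommGroup F] [NormedSpace ℝ F] [FiniteDimensional ℝ F]
  [MeasurableSpace F] [BorelSpace F]

/-- A set is nonporous at each of its Lebesgue density points. -/
lemma nonporousAt_of_tendsto_density (μ : Measure F) [μ.IsAddHaarMeasure] {M : Set F} {x : F}
    (hx : x ∈ M) (h : Tendsto (fun r => μ (M ∩ Metric.closedBall x r) / μ (Metric.closedBall x r))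
      (𝓝[>] 0) (𝓝 1)) : NonporousAt M univ x := by
  intro ε hε
  set d := Module.finrank ℝ F
  -- The volume fraction that the ball of radius `ε * s` about `y` takes up in the ball of radius
  -- `(1 + ε) * s` about `x`, where `s = dist y x`. A hole of this size contradicts density above `1
  -- - a`.
  set a : ℝ := (ε / (1 + ε)) ^ d with ha
  have ha0 : 0 < a := by positivity
  have ha1 : a ≤ 1 := pow_le_one₀ (by positivity) (by rw [div_le_one (by positivity)]; linarith)
  have hlt : ENNReal.ofReal (1 - a) < 1 := by
    rw [ENNReal.ofReal_lt_one]; linarith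
  obtain ⟨r₀, hr₀, H⟩ := mem_nhdsGT_iff_exists_Ioo_subset.1 (h.eventually (lt_mem_nhds hlt))
  have hr₀ : 0 < r₀ := hr₀
  refine ⟨r₀ / (1 + ε), by positivity, fun y _ hy => ?_⟩
  rw [lt_div_iff₀ (by positivity)] at hy
  by_contra! hcon
  set s := dist y x
  have hs : 0 < s := by
    refine lt_of_le_of_ne dist_nonneg fun h0 => ?_
    have h1 := hcon x hx
    rw [dist_comm x y] at h1
    change ε * s < s at h1
    rw [← h0] at h1
    simp at h1
  set r := (1 + ε) * s with hr
  have hrpos : 0 < r := by positivity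
  have hratio : ENNReal.ofReal (1 - a) <
      μ (M ∩ Metric.closedBall x r) / μ (Metric.closedBall x r) :=
    H ⟨hrpos, by rw [hr]; linarith⟩
  have hfin : μ (Metric.closedBall x r) ≠ ∞ := measure_closedBall_lt_top.ne
  have hpos : μ (Metric.closedBall x r) ≠ 0 := (Metric.measure_closedBall_pos μ x hrpos).ne'
  rw [ENNReal.lt_div_iff_mul_lt (Or.inl hpos) (Or.inl hfin)] at hratio
  have hball : μ (Metric.ball y (ε * s)) = ENNReal.ofReal a * μ (Metric.closedBall x r) := by
    rw [Measure.addHaar_ball_of_pos μ y (by positivity), Measure.addHaar_closedBall μ x hrpos.le,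
      ← mul_assoc, ← ENNReal.ofReal_mul ha0.le, ha, ← mul_pow]
    congr 3
    rw [hr]; field_simp
  have hdisj : Disjoint (M ∩ Metric.closedBall x r) (Metric.ball y (ε * s)) := by
    rw [Set.disjoint_left]
    intro m hm hmy
    exact (hcon m hm.1).not_gt hmy
  have hsub : (M ∩ Metric.closedBall x r) ∪ Metric.ball y (ε * s) ⊆ Metric.closedBall x r := by
    refine union_subset inter_subset_right fun z hz => ?_
    rw [Metric.mem_ball] at hz
    have := dist_triangle z y x
    rw [Metric.mem_closedBall, hr]
    have e : dist y x = s := rfl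
    linarith
  have hsum := measure_mono (μ := μ) hsub
  rw [measure_union hdisj measurableSet_ball, hball] at hsum
  have hsplit : μ (Metric.closedBall x r) =
      ENNReal.ofReal (1 - a) * μ (Metric.closedBall x r) +
        ENNReal.ofReal a * μ (Metric.closedBall x r) := by
    rw [← add_mul, ← ENNReal.ofReal_add (by linarith) ha0.le]; simp
  have hlt' := ENNReal.add_lt_add_right
    (ENNReal.mul_ne_top (ENNReal.ofReal_ne_top (r := a)) hfin) hratio
  rw [← hsplit] at hlt'
  exact (hlt'.trans_le hsum).false

/-- The Besicovitch density theorem, in a form that needs no measurability of `M`. -/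
lemma measure_not_nonporousAt_eq_zero (μ : Measure F) [μ.IsAddHaarMeasure] (M : Set F) :
    μ {x ∈ M | ¬ NonporousAt M univ x} = 0 := by
  have h := ae_iff.1 (Besicovitch.ae_tendsto_measure_inter_div μ M)
  refine measure_mono_null (fun x hx => ?_)
    (le_antisymm ((Measure.le_restrict_apply M _).trans h.le) zero_le)
  exact ⟨fun ht => hx.2 (nonporousAt_of_tendsto_density μ hx.1 ht), hx.1⟩

/-- A subset `M` of a set `S` that embeds bi-Lipschitzly into a `d`-dimensional space is nonporous
in `S` at `d`-dimensionally almost all of its points. -/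
lemma euclideanHausdorffMeasure_not_nonporousAt_eq_zero {X : Type*} [MetricSpace X]
    [MeasurableSpace X] [BorelSpace X] {M S : Set X} (hMS : M ⊆ S) {p : X → F} {K : ℝ}
    (hK : 0 < K) (hp : ∀ x ∈ S, ∀ y ∈ S, dist (p x) (p y) ≤ dist x y)
    (hp' : ∀ x ∈ S, ∀ y ∈ S, dist x y ≤ K * dist (p x) (p y)) :
    μHE[Module.finrank ℝ F] {x ∈ M | ¬ NonporousAt M S x} = 0 := by
  set Z := {x ∈ M | ¬ NonporousAt M S x}
  have himage : p '' Z ⊆ {v ∈ p '' M | ¬ NonporousAt (p '' M) univ v} := by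
    rintro _ ⟨x, ⟨hxM, hx⟩, rfl⟩
    refine ⟨⟨x, hxM, rfl⟩, fun hnp => hx fun ε hε => ?_⟩
    obtain ⟨δ, hδ, H⟩ := hnp (ε / K) (by positivity)
    refine ⟨δ, hδ, fun y hy hyx => ?_⟩
    have h1 := hp y hy x (hMS hxM)
    obtain ⟨_, ⟨m, hm, rfl⟩, hmy⟩ := H (p y) (mem_univ _) (h1.trans_lt hyx)
    refine ⟨m, hm, (hp' m (hMS hm) y hy).trans ?_⟩
    calc K * dist (p m) (p y) ≤ K * (ε / K * dist (p y) (p x)) := by gcongr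
      _ = ε * dist (p y) (p x) := by field_simp
      _ ≤ _ := by gcongr
  have hnull : μHE[Module.finrank ℝ F] (p '' Z) = 0 :=
    measure_mono_null himage (measure_not_nonporousAt_eq_zero _ _)
  rw [Measure.euclideanHausdorffMeasure_def, Measure.smul_apply, ENNReal.smul_def, smul_eq_mul,
    mul_eq_zero] at hnull ⊢
  refine hnull.imp id fun hnull => ?_
  have hZS : Z ⊆ S := fun x hx => hMS hx.1
  have hinj : InjOn p Z := fun x hx y hy hxy => by
    have := hp' x (hZS hx) y (hZS hy)
    rw [hxy, dist_self, mul_zero] at this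
    exact dist_le_zero.1 this
  rcases isEmpty_or_nonempty X with hX | hX
  · rw [Set.eq_empty_of_isEmpty Z, measure_empty]
  -- The inverse of `p` on its image is Lipschitz and carries the null set back to `Z`.
  set g := Function.invFunOn p Z
  have hg : ∀ x ∈ Z, g (p x) = x := fun x hx => hinj.leftInvOn_invFunOn hx
  have hLip : LipschitzOnWith K.toNNReal g (p '' Z) := by
    refine LipschitzOnWith.of_dist_le_mul ?_
    rintro _ ⟨x, hx, rfl⟩ _ ⟨y, hy, rfl⟩
    rw [hg x hx, hg y hy, Real.coe_toNNReal _ hK.le]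
    exact hp' x (hZS hx) y (hZS hy)
  have hgZ : g '' (p '' Z) = Z := by
    rw [image_image]
    exact (image_congr hg).trans (image_id' Z)
  have := hLip.hausdorffMeasure_image_le (d := Module.finrank ℝ F) (by positivity)
  rw [hgZ, hnull, mul_zero] at this
  exact le_antisymm this zero_le

end Density

/-! ### Gnomonic coordinates on the sphere -/

section Sphere

variable {n : ℕ}

lemma norm_coe_sphere (v : USphere n) : ‖(v : Ambient n)‖ = 1 := by simp

lemma coe_mem_radialExtension {K : Set (USphere n)} {v : USphere n} (hv : v ∈ K) :
    (v : Ambient n) ∈ radialExtension K := ⟨1, zero_le_one, v, hv, (one_smul ℝ _).symm⟩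

lemma coe_mem_radialExtension_iff {K : Set (USphere n)} {v : USphere n} :
    (v : Ambient n) ∈ radialExtension K ↔ v ∈ K := by
  refine ⟨?_, coe_mem_radialExtension⟩
  rintro ⟨r, hr, u, hu, h⟩
  have h1 := congrArg norm h
  rw [norm_smul, norm_coe_sphere, norm_coe_sphere, mul_one, Real.norm_of_nonneg hr] at h1
  rw [← h1, one_smul] at h
  rwa [Subtype.ext h]

lemma smul_mem_radialExtension {K : Set (USphere n)} {x : Ambient n} (hx : x ∈ radialExtension K)
    {c : ℝ} (hc : 0 ≤ c) : c • x ∈ radialExtension K := by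
  obtain ⟨r, hr, u, hu, rfl⟩ := hx
  exact ⟨c * r, by positivity, u, hu, smul_smul _ _ _⟩

lemma smul_mem_radialExtension_iff {K : Set (USphere n)} {x : Ambient n} {c : ℝ} (hc : 0 < c) :
    c • x ∈ radialExtension K ↔ x ∈ radialExtension K := by
  refine ⟨fun h => ?_, fun h => smul_mem_radialExtension h hc.le⟩
  have := smul_mem_radialExtension h (inv_pos.2 hc).le
  rwa [inv_smul_smul₀ hc.ne'] at this

lemma add_mem_radialExtension {K : Set (USphere n)} (hK : Convex ℝ (radialExtension K))
    {x y : Ambient n} (hx : x ∈ radialExtension K) (hy : y ∈ radialExtension K) :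
    x + y ∈ radialExtension K := by
  have := smul_mem_radialExtension (hK hx hy (show (0 : ℝ) ≤ 1 / 2 by norm_num)
    (show (0 : ℝ) ≤ 1 / 2 by norm_num) (by norm_num)) (show (0 : ℝ) ≤ 2 by norm_num)
  convert this using 1
  module

/-- Nonemptiness is needed for the cones to intersect correctly: the radial extension of the empty
set is empty, whereas two nonempty cones share the origin. -/
lemma IsSphericalConvexBody.inter {K L : Set (USphere n)} (hK : IsSphericalConvexBody K)
    (hL : IsSphericalConvexBody L) (hne : (K ∩ L).Nonempty) : IsSphericalConvexBody (K ∩ L) := by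
  refine ⟨hK.1.inter hL.1, ?_⟩
  convert hK.2.inter hL.2 using 1
  ext x
  constructor
  · rintro ⟨r, hr, u, hu, rfl⟩
    exact ⟨⟨r, hr, u, hu.1, rfl⟩, ⟨r, hr, u, hu.2, rfl⟩⟩
  · rintro ⟨⟨r, hr, u, hu, rfl⟩, hx⟩
    rcases hr.eq_or_lt with rfl | hr0
    · obtain ⟨v, hv⟩ := hne
      exact ⟨0, le_rfl, v, hv, by simp⟩
    · rw [smul_mem_radialExtension_iff hr0, coe_mem_radialExtension_iff] at hx
      exact ⟨r, hr, u, ⟨hu, hx⟩, rfl⟩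

variable (w : USphere n)

/-- The abbreviation for the tangent space of the sphere at `w`. -/
abbrev SphereTangent : Type := (ℝ ∙ (w : Ambient n))ᗮ

lemma inner_coe_tangent (x : SphereTangent w) : ⟪(w : Ambient n), (x : Ambient n)⟫ = 0 :=
  Submodule.mem_orthogonal_singleton_iff_inner_right.1 x.2

lemma inner_coe_sphere_self : ⟪(w : Ambient n), (w : Ambient n)⟫ = 1 := by
  rw [real_inner_self_eq_norm_sq, norm_coe_sphere, one_pow]

lemma inner_add_tangent (x : SphereTangent w) :
    ⟪(w : Ambient n), (x : Ambient n) + w⟫ = 1 := by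
  rw [inner_add_right, inner_coe_tangent, inner_coe_sphere_self, zero_add]

lemma one_le_norm_add (x : SphereTangent w) : 1 ≤ ‖(x : Ambient n) + w‖ := by
  have := real_inner_le_norm (w : Ambient n) ((x : Ambient n) + w)
  rwa [inner_add_tangent, norm_coe_sphere, one_mul] at this

/-- The inverse of the gnomonic projection at `w`. -/
noncomputable def gnomonicInv (x : SphereTangent w) : USphere n :=
  ⟨‖(x : Ambient n) + w‖⁻¹ • ((x : Ambient n) + w), by
    rw [mem_sphere_zero_iff_norm, norm_smul, norm_inv, norm_norm]
    exact inv_mul_cancel₀ (zero_lt_one.trans_le (one_le_norm_add w x)).ne'⟩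

lemma coe_gnomonicInv (x : SphereTangent w) :
    (gnomonicInv w x : Ambient n) = ‖(x : Ambient n) + w‖⁻¹ • ((x : Ambient n) + w) := rfl

lemma gnomonicInv_zero : gnomonicInv w 0 = w := by
  ext1; rw [coe_gnomonicInv]; simp

lemma continuous_gnomonicInv : Continuous (gnomonicInv w) := by
  have h : Continuous fun x : SphereTangent w => (x : Ambient n) + w := by fun_prop
  exact ((h.norm.inv₀ fun x => (zero_lt_one.trans_le (one_le_norm_add w x)).ne').smul h).subtype_mk _

lemma inner_gnomonicInv (x : SphereTangent w) :
    ⟪(w : Ambient n), (gnomonicInv w x : Ambient n)⟫ = ‖(x : Ambient n) + w‖⁻¹ := by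
  rw [coe_gnomonicInv, real_inner_smul_right, inner_add_tangent, mul_one]

lemma inner_gnomonicInv_pos (x : SphereTangent w) :
    0 < ⟪(w : Ambient n), (gnomonicInv w x : Ambient n)⟫ := by
  rw [inner_gnomonicInv]; exact inv_pos.2 (zero_lt_one.trans_le (one_le_norm_add w x))

/-- The central projection from the origin onto the affine tangent hyperplane at `w`. -/
noncomputable def centralProj (y : Ambient n) : SphereTangent w :=
  horizontal (w : Ambient n) (⟪(w : Ambient n), y⟫⁻¹ • y)

variable {w}

lemma coe_centralProj {y : Ambient n} (hy : ⟪(w : Ambient n), y⟫ ≠ 0) :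
    (centralProj w y : Ambient n) = ⟪(w : Ambient n), y⟫⁻¹ • y - w := by
  rw [centralProj, coe_horizontal (norm_coe_sphere w), real_inner_smul_left,
    real_inner_comm (w : Ambient n) y, inv_mul_cancel₀ (by simpa using hy), one_smul]

lemma continuousAt_centralProj {y : Ambient n} (hy : ⟪(w : Ambient n), y⟫ ≠ 0) :
    ContinuousAt (centralProj w) y := by
  refine ContinuousAt.comp (g := horizontal (w : Ambient n)) ?_ ?_
  · exact (ContinuousLinearMap.continuous _).continuousAt
  · exact ContinuousAt.smul (ContinuousAt.inv₀ (by fun_prop) hy) continuousAt_id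

lemma gnomonicInv_centralProj {v : USphere n} (hv : 0 < ⟪(w : Ambient n), (v : Ambient n)⟫) :
    gnomonicInv w (centralProj w v) = v := by
  ext1
  rw [coe_gnomonicInv, coe_centralProj hv.ne', sub_add_cancel, norm_smul, norm_coe_sphere, mul_one,
    Real.norm_of_nonneg (inv_pos.2 hv).le, inv_inv, smul_inv_smul₀ hv.ne']

lemma centralProj_gnomonicInv (x : SphereTangent w) : centralProj w (gnomonicInv w x) = x := by
  ext1
  have h := zero_lt_one.trans_le (one_le_norm_add w x)
  rw [coe_centralProj (inner_gnomonicInv_pos w x).ne', inner_gnomonicInv, inv_inv, coe_gnomonicInv,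
    smul_inv_smul₀ h.ne', add_sub_cancel_right]

lemma mem_gnomonicImage_iff {K : Set (USphere n)} {x : SphereTangent w} :
    x ∈ gnomonicImage w K ↔ gnomonicInv w x ∈ K := by
  constructor
  · rintro ⟨v, hv, hpos, hx⟩
    have : x = centralProj w v := by
      ext1; rw [hx, coe_centralProj hpos.ne', gnomonic]
    rwa [this, gnomonicInv_centralProj hpos]
  · intro h
    refine ⟨_, h, inner_gnomonicInv_pos w x, ?_⟩
    conv_lhs => rw [← centralProj_gnomonicInv x]
    rw [coe_centralProj (inner_gnomonicInv_pos w x).ne', gnomonic]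

lemma gnomonicImage_eq_preimage (K : Set (USphere n)) :
    gnomonicImage w K = gnomonicInv w ⁻¹' K := by
  ext x; exact mem_gnomonicImage_iff

/-- The gnomonic image is the slice of the cone by the affine tangent hyperplane; convexity of the
image is read off from this. -/
lemma mem_gnomonicImage_iff_add_mem {K : Set (USphere n)} {x : SphereTangent w} :
    x ∈ gnomonicImage w K ↔ (x : Ambient n) + w ∈ radialExtension K := by
  rw [mem_gnomonicImage_iff, ← coe_mem_radialExtension_iff, coe_gnomonicInv,
    smul_mem_radialExtension_iff (inv_pos.2 (zero_lt_one.trans_le (one_le_norm_add w x)))]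

lemma IsSphericalConvexBody.isClosed_gnomonicImage {K : Set (USphere n)}
    (hK : IsSphericalConvexBody K) : IsClosed (gnomonicImage w K) := by
  rw [gnomonicImage_eq_preimage]
  exact hK.1.preimage (continuous_gnomonicInv w)

lemma IsSphericalConvexBody.convex_gnomonicImage {K : Set (USphere n)}
    (hK : IsSphericalConvexBody K) : Convex ℝ (gnomonicImage w K) := by
  intro x hx y hy a b ha hb hab
  rw [mem_gnomonicImage_iff_add_mem] at hx hy ⊢
  have h : a • ((x : Ambient n) + w) + b • ((y : Ambient n) + w) =
      (a • (x : Ambient n) + b • (y : Ambient n)) + (a + b) • (w : Ambient n) := by module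
  have h2 := hK.2 hx hy ha hb hab
  rw [h, hab, one_smul] at h2
  exact h2

lemma zero_mem_gnomonicImage {K : Set (USphere n)} : 0 ∈ gnomonicImage w K ↔ w ∈ K := by
  rw [mem_gnomonicImage_iff, gnomonicInv_zero]

lemma interior_gnomonicImage (K : Set (USphere n)) :
    interior (gnomonicImage w K) = gnomonicInv w ⁻¹' interior K := by
  refine Subset.antisymm (fun x hx => ?_) ?_
  · have hpos := inner_gnomonicInv_pos w x
    refine mem_interior_iff_mem_nhds.2 ?_
    have h1 : ContinuousAt (fun v : USphere n => centralProj w v) (gnomonicInv w x) :=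
      ContinuousAt.comp (g := centralProj w) (continuousAt_centralProj hpos.ne')
        continuous_subtype_val.continuousAt
    have h2 : ContinuousAt (fun v : USphere n => ⟪(w : Ambient n), (v : Ambient n)⟫)
        (gnomonicInv w x) := by fun_prop
    have hx' : gnomonicImage w K ∈ 𝓝 (centralProj w (gnomonicInv w x)) := by
      rw [centralProj_gnomonicInv]; exact mem_interior_iff_mem_nhds.1 hx
    filter_upwards [h1.eventually hx', h2.eventually (lt_mem_nhds hpos)] with v hv hv'
    have := mem_gnomonicImage_iff.1 hv
    rwa [gnomonicInv_centralProj hv'] at this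
  · rw [gnomonicImage_eq_preimage]
    exact preimage_interior_subset_interior_preimage (continuous_gnomonicInv w)

lemma IsClosed.frontier_gnomonicImage {K : Set (USphere n)} (hK : IsClosed K) :
    frontier (gnomonicImage w K) = gnomonicInv w ⁻¹' frontier K := by
  have : IsClosed (gnomonicImage w K) := by
    rw [gnomonicImage_eq_preimage]; exact hK.preimage (continuous_gnomonicInv w)
  rw [this.frontier_eq, hK.frontier_eq, interior_gnomonicImage, gnomonicImage_eq_preimage,
    preimage_sdiff]

lemma dist_gnomonicInv_le (x : SphereTangent w) : dist (gnomonicInv w x) w ≤ 2 * ‖x‖ := by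
  rw [Subtype.dist_eq, dist_eq_norm, coe_gnomonicInv]
  set y := (x : Ambient n) + w with hy
  have h1 : 1 ≤ ‖y‖ := one_le_norm_add w x
  have h2 : ‖‖y‖⁻¹ • y - y‖ ≤ ‖x‖ := by
    have e1 : ‖y‖⁻¹ • y - y = (‖y‖⁻¹ - 1) • y := by rw [sub_smul, one_smul]
    have e2 : ‖y‖ ≤ ‖x‖ + 1 := by
      have := norm_add_le (x : Ambient n) w
      rwa [norm_coe_sphere] at this
    rw [e1, norm_smul, Real.norm_eq_abs, ← abs_norm y, ← abs_mul, abs_norm, sub_mul,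
      inv_mul_cancel₀ (by positivity), abs_sub_comm, abs_of_nonneg (by linarith)]
    linarith
  have h3 : ‖y‖⁻¹ • y - (w : Ambient n) = (‖y‖⁻¹ • y - y) + x := by rw [hy]; abel
  rw [h3]
  refine (norm_add_le _ _).trans ?_
  have e : ‖(x : Ambient n)‖ = ‖x‖ := rfl
  linarith

lemma half_le_inner_of_dist_le {v : USphere n} (h : dist v w ≤ 1) :
    1 / 2 ≤ ⟪(w : Ambient n), (v : Ambient n)⟫ := by
  rw [Subtype.dist_eq, dist_eq_norm] at h
  have h1 := norm_sub_sq_real (v : Ambient n) w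
  rw [norm_coe_sphere, norm_coe_sphere, real_inner_comm] at h1
  nlinarith [norm_nonneg ((v : Ambient n) - w)]

lemma norm_centralProj_sub_le {u v : USphere n}
    (hu : 1 / 2 ≤ ⟪(w : Ambient n), (u : Ambient n)⟫)
    (hv : 1 / 2 ≤ ⟪(w : Ambient n), (v : Ambient n)⟫) :
    ‖centralProj w u - centralProj w v‖ ≤ 6 * dist u v := by
  refine (norm_horizontal_sub_le _ _ _).trans ?_
  rw [Subtype.dist_eq, dist_eq_norm]
  set a := ⟪(w : Ambient n), (u : Ambient n)⟫
  set b := ⟪(w : Ambient n), (v : Ambient n)⟫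
  have hab : |b - a| ≤ ‖(u : Ambient n) - v‖ := by
    have h1 : b - a = ⟪(w : Ambient n), (v : Ambient n) - u⟫ := by rw [inner_sub_right]
    have := abs_real_inner_le_norm (w : Ambient n) ((v : Ambient n) - u)
    rwa [← h1, norm_coe_sphere, one_mul, norm_sub_rev] at this
  have e1 : a⁻¹ • (u : Ambient n) - b⁻¹ • (v : Ambient n) =
      a⁻¹ • ((u : Ambient n) - v) + (a⁻¹ * b⁻¹ * (b - a)) • (v : Ambient n) := by
    have : a⁻¹ * b⁻¹ * (b - a) = a⁻¹ - b⁻¹ := by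
      have : a ≠ 0 := by linarith
      have : b ≠ 0 := by linarith
      field_simp
    rw [this]; module
  have ha2 : a⁻¹ ≤ 2 := by rw [inv_le_comm₀ (by linarith) two_pos]; linarith
  have hb2 : b⁻¹ ≤ 2 := by rw [inv_le_comm₀ (by linarith) two_pos]; linarith
  have ha0 : 0 ≤ a⁻¹ := inv_nonneg.2 (by linarith)
  have hb0 : 0 ≤ b⁻¹ := inv_nonneg.2 (by linarith)
  rw [e1]
  refine (norm_add_le _ _).trans ?_
  rw [norm_smul, norm_smul, norm_coe_sphere, mul_one, Real.norm_of_nonneg ha0, Real.norm_eq_abs,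
    abs_mul, abs_of_nonneg (mul_nonneg ha0 hb0)]
  have h1 : a⁻¹ * ‖(u : Ambient n) - v‖ ≤ 2 * ‖(u : Ambient n) - v‖ := by gcongr
  have h2 : a⁻¹ * b⁻¹ * |b - a| ≤ 2 * 2 * ‖(u : Ambient n) - v‖ := by gcongr
  linarith

lemma NonporousAt.preimage_gnomonicInv {M S : Set (USphere n)} (h : NonporousAt M S w) :
    NonporousAt (gnomonicInv w ⁻¹' M) (gnomonicInv w ⁻¹' S) 0 := by
  intro ε hε
  -- `12 = 6 * 2` is the product of the two Lipschitz constants. The bound `1`, with `‖y‖ < 1 / 4`,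
  -- keeps `m` within distance `1` of `w`, where the central projection is controlled.
  obtain ⟨δ, hδ, H⟩ := h (min 1 (ε / 12)) (by positivity)
  refine ⟨min (δ / 2) (1 / 4), by positivity, fun y hy hy0 => ?_⟩
  rw [dist_zero_right] at hy0 ⊢
  rw [lt_min_iff] at hy0
  have h1 := dist_gnomonicInv_le y
  obtain ⟨m, hm, hmy⟩ := H _ hy (by linarith)
  have h2 : dist m (gnomonicInv w y) ≤ dist (gnomonicInv w y) w :=
    hmy.trans (mul_le_of_le_one_left dist_nonneg (min_le_left _ _))
  have h3 : dist m (gnomonicInv w y) ≤ ε / 12 * (2 * ‖y‖) :=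
    hmy.trans (mul_le_mul (min_le_right _ _) h1 dist_nonneg (by positivity))
  have hm2 : 1 / 2 ≤ ⟪(w : Ambient n), (m : Ambient n)⟫ := half_le_inner_of_dist_le (by
    have := dist_triangle m (gnomonicInv w y) w
    linarith)
  refine ⟨centralProj w m, ?_, ?_⟩
  · rw [mem_preimage, gnomonicInv_centralProj (by linarith)]; exact hm
  · have := norm_centralProj_sub_le hm2 (half_le_inner_of_dist_le (h1.trans (by linarith)))
    rw [centralProj_gnomonicInv] at this
    rw [dist_eq_norm]
    linarith

lemma finrank_sphereTangent (w : USphere n) : Module.finrank ℝ (SphereTangent w) = n := by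
  have : Fact (Module.finrank ℝ (Ambient n) = n + 1) := ⟨by simp⟩
  exact Submodule.finrank_orthogonal_span_singleton
    (norm_ne_zero_iff.1 (by rw [norm_coe_sphere]; exact one_ne_zero))

/-- Nested spherical convex bodies whose common boundary part is nonporous at `w` have the same
curvature there. -/
theorem sphericalCurvature_eq_of_nonporousAt (hn : 2 ≤ n) {A B : Set (USphere n)}
    (hA : IsSphericalConvexBody A) (hB : IsSphericalConvexBody B) (hAB : A ⊆ B) (hwA : w ∈ A)
    (hwB : w ∈ frontier B) (h : NonporousAt (A ∩ frontier B) (frontier B) w) :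
    sphericalCurvature A w = sphericalCurvature B w := by
  refine gaussKroneckerCurvature_eq_of_nonporousAt (by rwa [finrank_sphereTangent])
    hB.isClosed_gnomonicImage hB.convex_gnomonicImage hA.isClosed_gnomonicImage
    hA.convex_gnomonicImage ?_ (zero_mem_gnomonicImage.2 hwA) ?_ ?_
  · rw [gnomonicImage_eq_preimage, gnomonicImage_eq_preimage]; exact preimage_mono hAB
  · rw [hB.1.frontier_gnomonicImage, mem_preimage, gnomonicInv_zero]; exact hwB
  · rw [hB.1.frontier_gnomonicImage, gnomonicImage_eq_preimage]
    exact h.preimage_gnomonicInv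

theorem sphericalCurvature_eq_zero_of_union_mem_nhds (hn : 2 ≤ n) {A B : Set (USphere n)}
    (hA : IsSphericalConvexBody A) (hB : IsSphericalConvexBody B) (hwA : w ∈ frontier A)
    (hwB : w ∈ frontier B) (h : w ∈ interior (A ∪ B)) :
    sphericalCurvature A w = 0 ∧ sphericalCurvature (A ∩ B) w = 0 := by
  rw [sphericalCurvature, sphericalCurvature, gnomonicImage_eq_preimage (A ∩ B), preimage_inter,
    ← gnomonicImage_eq_preimage, ← gnomonicImage_eq_preimage]
  have hB' := hwB
  rw [hB.1.frontier_eq] at hB'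
  refine gaussKroneckerCurvature_eq_zero_of_union_mem_nhds (by rwa [finrank_sphereTangent])
    hA.isClosed_gnomonicImage hA.convex_gnomonicImage hB.convex_gnomonicImage ?_
    (zero_mem_gnomonicImage.2 hB'.1) ?_ ?_
  · rw [hA.1.frontier_gnomonicImage, mem_preimage, gnomonicInv_zero]; exact hwA
  · rw [interior_gnomonicImage, mem_preimage, gnomonicInv_zero]; exact hB'.2
  · rw [gnomonicImage_eq_preimage, gnomonicImage_eq_preimage, ← preimage_union,
      ← gnomonicImage_eq_preimage]
    refine mem_interior_iff_mem_nhds.1 ?_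
    rw [interior_gnomonicImage, mem_preimage, gnomonicInv_zero]
    exact h

end Sphere

/-! ### Boundaries of unions and intersections -/

section FrontierDecomposition

variable {X : Type*} [TopologicalSpace X] {K L : Set X}

lemma IsClosed.mem_interior_of_mem_interior_union (hL : IsClosed L) {x : X} (hx : x ∉ L)
    (h : x ∈ interior (K ∪ L)) : x ∈ interior K := by
  rw [mem_interior_iff_mem_nhds] at h ⊢
  filter_upwards [h, hL.isOpen_compl.mem_nhds hx] with v hv hvL
  exact hv.resolve_right hvL

/-- Common boundary points can become interior to the union, so only part of them survives here,
whereas the intersection keeps them all. -/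
lemma IsClosed.frontier_union_eq (hK : IsClosed K) (hL : IsClosed L) :
    frontier (K ∪ L) = frontier K \ L ∪ frontier L \ K ∪
      frontier K ∩ frontier L ∩ frontier (K ∪ L) := by
  ext x
  have h1 : x ∈ interior K → x ∈ interior (K ∪ L) := fun h => interior_mono subset_union_left h
  have h2 : x ∈ interior L → x ∈ interior (K ∪ L) := fun h => interior_mono subset_union_right h
  have h3 : x ∉ L → x ∈ interior (K ∪ L) → x ∈ interior K :=
    hL.mem_interior_of_mem_interior_union
  have h4 : x ∉ K → x ∈ interior (K ∪ L) → x ∈ interior L := fun h h' =>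
    hK.mem_interior_of_mem_interior_union h (union_comm K L ▸ h')
  rw [(hK.union hL).frontier_eq, hK.frontier_eq, hL.frontier_eq]
  simp only [mem_inter_iff, mem_union, Set.mem_sdiff]
  tauto

lemma IsClosed.frontier_inter_eq (hK : IsClosed K) (hL : IsClosed L) :
    frontier (K ∩ L) = frontier K ∩ interior L ∪ frontier L ∩ interior K ∪
      frontier K ∩ frontier L := by
  ext x
  have h1 : x ∈ interior K → x ∈ K := fun h => interior_subset h
  have h2 : x ∈ interior L → x ∈ L := fun h => interior_subset h
  rw [(hK.inter hL).frontier_eq, hK.frontier_eq, hL.frontier_eq, interior_inter]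
  simp only [mem_inter_iff, mem_union, Set.mem_sdiff]
  tauto

end FrontierDecomposition

/-! ### Local bi-Lipschitz charts of the boundary -/

section Chart

variable {n : ℕ} {w : USphere n}

lemma exists_ball_subset_radialExtension {B : Set (USphere n)} {x₀ : SphereTangent w}
    (hx₀ : x₀ ∈ interior (gnomonicImage w B)) :
    ∃ r > 0, Metric.ball ((x₀ : Ambient n) + w) r ⊆ radialExtension B := by
  refine Metric.mem_nhds_iff.1 ?_
  have h1 : ⟪(w : Ambient n), (x₀ : Ambient n) + w⟫ = 1 := inner_add_tangent w x₀
  have hc : centralProj w ((x₀ : Ambient n) + w) = x₀ := by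
    ext1
    rw [coe_centralProj (by rw [h1]; exact one_ne_zero), h1, inv_one, one_smul,
      add_sub_cancel_right]
  have hmem : gnomonicImage w B ∈ 𝓝 (centralProj w ((x₀ : Ambient n) + w)) := by
    rw [hc]; exact mem_interior_iff_mem_nhds.1 hx₀
  have hinner : ContinuousAt (fun y : Ambient n => ⟪(w : Ambient n), y⟫) ((x₀ : Ambient n) + w) := by
    fun_prop
  filter_upwards [(continuousAt_centralProj (by rw [h1]; exact one_ne_zero)).eventually hmem,
    hinner.eventually (lt_mem_nhds (zero_lt_one.trans_eq h1.symm))] with y hy hy'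
  have h2 := mem_gnomonicImage_iff_add_mem.1 hy
  rwa [coe_centralProj hy'.ne', sub_add_cancel, smul_mem_radialExtension_iff (inv_pos.2 hy')] at h2

/-- The slack `r - ‖q‖` absorbs any small displacement of `y`, and the cone is closed under
nonnegative combinations. -/
lemma mem_interior_of_eq_smul_add_smul {B : Set (USphere n)} (hB : Convex ℝ (radialExtension B))
    {c : Ambient n} {r : ℝ} (hc : Metric.ball c r ⊆ radialExtension B) {x y : USphere n} (hx : x ∈ B)
    {l b : ℝ} (hl : 0 ≤ l) (hb : 0 < b) {q : Ambient n} (hq : ‖q‖ < r)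
    (hy : (y : Ambient n) = l • (x : Ambient n) + b • (c + q)) : y ∈ interior B := by
  refine mem_interior_iff_mem_nhds.2 ?_
  have hcont : ContinuousAt (fun v : USphere n => ‖q + b⁻¹ • ((v : Ambient n) - y)‖) y := by
    fun_prop
  filter_upwards [hcont.eventually (gt_mem_nhds (show _ < r by simpa using hq))] with v hv
  rw [← coe_mem_radialExtension_iff]
  have h1 : (v : Ambient n) =
      l • (x : Ambient n) + b • (c + (q + b⁻¹ • ((v : Ambient n) - y))) := by
    rw [← add_assoc c, smul_add b (c + q), smul_inv_smul₀ hb.ne', ← add_assoc, ← hy]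
    abel
  rw [h1]
  refine add_mem_radialExtension hB
    (smul_mem_radialExtension (coe_mem_radialExtension hx) hl)
    (smul_mem_radialExtension (hc ?_) hb.le)
  rw [mem_ball_iff_norm, add_sub_cancel_left]
  exact hv

/-- The projection of the ambient space along `w` and the tangent vector `e`. -/
noncomputable def flatProj (w : USphere n) (e : SphereTangent w) (y : Ambient n) : (ℝ ∙ e)ᗮ :=
  horizontal e (horizontal (w : Ambient n) y)

lemma flatProj_sub (e : SphereTangent w) (x y : Ambient n) :
    flatProj w e x - flatProj w e y = flatProj w e (x - y) := by
  simp only [flatProj, horizontal, map_sub]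

lemma eq_add_flatProj {e : SphereTangent w} (he : ‖e‖ = 1) (y : Ambient n) :
    y = ⟪y, w⟫ • (w : Ambient n) + ⟪horizontal (w : Ambient n) y, e⟫ • (e : Ambient n) +
      ((flatProj w e y : SphereTangent w) : Ambient n) := by
  rw [flatProj, coe_horizontal he, Submodule.coe_sub, coe_horizontal (norm_coe_sphere w),
    Submodule.coe_smul]
  abel

/-- For small `ρ` the vertical parts `|a|` and `b * X` take up at most half of `d`, apart from a
multiple of `p`, and can be absorbed. -/
lemma le_of_flat_estimates {a b d p r ρ X : ℝ} (hr : 0 < r) (hX : 0 < X) (hρ0 : 0 ≤ ρ)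
    (hρ1 : ρ ≤ 1 / 4) (hρ3 : ρ ≤ r / 2) (hρ4 : 2 * X * ρ ≤ r) (hb0 : 0 ≤ b) (hd0 : 0 ≤ d)
    (ha : |a| ≤ ρ * d) (hbr : b * r ≤ (|a| + b) * ρ + p) (hd : d ≤ |a| + b * X + p) :
    d ≤ 2 * (2 * X / r + 1) * p := by
  have hb2 : b * r ≤ 2 * (ρ * ρ * d + p) := by
    have h1 : |a| * ρ ≤ ρ * d * ρ := by gcongr
    have h2 : b * ρ ≤ b * (r / 2) := by gcongr
    linarith
  have hb3 : b * X ≤ 1 / 4 * d + 2 * X / r * p := by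
    have h1 : b ≤ 2 * (ρ * ρ * d + p) / r := (le_div_iff₀ hr).2 hb2
    calc b * X ≤ 2 * (ρ * ρ * d + p) / r * X := by gcongr
      _ = (2 * X * ρ) * ρ * d / r + 2 * X / r * p := by field_simp
      _ ≤ r * (1 / 4) * d / r + 2 * X / r * p := by gcongr
      _ = _ := by field_simp
  have h1 : ρ * d ≤ 1 / 4 * d := by gcongr
  linarith

/-- Decompose `y - x = a • w + b • x₀ + p`. The sphere makes `a` small relative to the distance, and
a `b` too large for `p` would push `y` into the interior along the cone. So `p` controls everything.
-/
lemma dist_le_mul_dist_flatProj_of_nonneg {B : Set (USphere n)} (hB : IsSphericalConvexBody B)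
    {x₀ e : SphereTangent w} {r ρ X : ℝ} (hr : 0 < r)
    (hball : Metric.ball ((x₀ : Ambient n) + w) r ⊆ radialExtension B) (hX : 0 < X)
    (he_def : e = X⁻¹ • x₀) (he : ‖e‖ = 1) (hρ : 0 < ρ) (hρ1 : ρ ≤ 1 / 4) (hρ2 : ρ ≤ X / 4)
    (hρ3 : ρ ≤ r / 2) (hρ4 : 2 * X * ρ ≤ r) {x y : USphere n}
    (hxB : x ∈ frontier B) (hxw : x ∈ Metric.ball w ρ) (hyB : y ∈ frontier B)
    (hyw : y ∈ Metric.ball w ρ)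
    (hpos : 0 ≤ ⟪horizontal (w : Ambient n) ((y : Ambient n) - x), e⟫) :
    dist x y ≤ 2 * (2 * X / r + 1) * dist (flatProj w e x) (flatProj w e y) := by
  rw [hB.1.frontier_eq] at hxB hyB
  rw [Metric.mem_ball, Subtype.dist_eq, dist_eq_norm] at hxw hyw
  rw [dist_comm x y, dist_comm (flatProj w e x), Subtype.dist_eq, dist_eq_norm, dist_eq_norm,
    flatProj_sub]
  set h := (y : Ambient n) - x with hh
  set d := ‖h‖
  set a := ⟪h, (w : Ambient n)⟫
  set p := ((flatProj w e h : SphereTangent w) : Ambient n) with hp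
  have hpn : ‖flatProj w e h‖ = ‖p‖ := rfl
  rw [hpn]
  set b := ⟪horizontal (w : Ambient n) h, e⟫ / X with hb
  have hb0 : 0 ≤ b := by positivity
  have hdec : h = a • (w : Ambient n) + b • (x₀ : Ambient n) + p := by
    have h1 := eq_add_flatProj he h
    rw [he_def, Submodule.coe_smul, smul_smul, ← he_def, ← div_eq_mul_inv] at h1
    exact h1
  have hd0 : 0 ≤ d := norm_nonneg _
  have hp0 : 0 ≤ ‖p‖ := norm_nonneg _
  have ha : |a| ≤ ρ * d := by
    -- A chord of the sphere is orthogonal to the sum of its endpoints.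
    have h1 : 2 * a = ⟪h, ((w : Ambient n) - x) + ((w : Ambient n) - y)⟫ := by
      have h2 : ⟪h, (x : Ambient n) + y⟫ = 0 := by
        rw [hh, inner_sub_left, inner_add_right, inner_add_right, real_inner_self_eq_norm_sq,
          real_inner_self_eq_norm_sq, norm_coe_sphere, norm_coe_sphere, real_inner_comm]
        ring
      have h3 : ((w : Ambient n) - x) + ((w : Ambient n) - y) =
          (2 : ℝ) • (w : Ambient n) - ((x : Ambient n) + y) := by module
      rw [h3, inner_sub_right, h2, real_inner_smul_right, sub_zero]
    have h4 := abs_real_inner_le_norm h (((w : Ambient n) - x) + ((w : Ambient n) - y))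
    rw [← h1, abs_mul, abs_two] at h4
    have h5 : ‖((w : Ambient n) - x) + ((w : Ambient n) - y)‖ ≤ ρ + ρ := by
      refine (norm_add_le _ _).trans ?_
      rw [norm_sub_rev, norm_sub_rev (w : Ambient n) y]
      linarith
    have h6 : d * ‖((w : Ambient n) - x) + ((w : Ambient n) - y)‖ ≤ d * (ρ + ρ) := by gcongr
    linarith
  have hd : d ≤ 2 * ρ := by
    have h1 : h = ((y : Ambient n) - w) - ((x : Ambient n) - w) := by rw [hh]; abel
    have h2 : d ≤ ‖(y : Ambient n) - w‖ + ‖(x : Ambient n) - w‖ := by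
      change ‖h‖ ≤ _
      rw [h1]; exact norm_sub_le _ _
    linarith
  have hbX : b * X ≤ d := by
    rw [hb, div_mul_cancel₀ _ hX.ne']
    refine (real_inner_le_norm _ _).trans ?_
    rw [he, mul_one]
    have := norm_horizontal_sub_le (w : Ambient n) h 0
    rwa [horizontal, horizontal, map_zero, sub_zero, sub_zero] at this
  have hb1 : b ≤ 1 / 2 := by
    have : b * X ≤ 1 / 2 * X := by linarith
    exact le_of_mul_le_mul_right this hX
  have hbr : b * r ≤ (|a| + b) * ρ + ‖p‖ := by
    rcases hb0.eq_or_lt with hb00 | hbpos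
    · rw [← hb00]; nlinarith [abs_nonneg a]
    by_contra! hlt
    set q := b⁻¹ • ((a - b) • ((w : Ambient n) - x) + p) with hq
    have hqn : ‖q‖ < r := by
      rw [hq, norm_smul, norm_inv, Real.norm_of_nonneg hb0, inv_mul_lt_iff₀ hbpos]
      refine lt_of_le_of_lt ?_ hlt
      refine (norm_add_le _ _).trans ?_
      rw [norm_smul, Real.norm_eq_abs, norm_sub_rev]
      have h1 : |a - b| ≤ |a| + b := (abs_sub _ _).trans (by rw [abs_of_nonneg hb0])
      gcongr
    -- The coefficient of `x` in the conic combination that represents `y`.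
    have hl : 0 ≤ 1 + a - b := by
      have := (abs_le.1 ha).1
      nlinarith
    refine hyB.2 (mem_interior_of_eq_smul_add_smul hB.2 hball hxB.1 hl hbpos hqn ?_)
    have hyx : (y : Ambient n) = x + h := by rw [hh]; abel
    rw [smul_add b, hq, smul_inv_smul₀ hbpos.ne', hyx, hdec]
    module
  have hdle : d ≤ |a| + b * X + ‖p‖ := by
    change ‖h‖ ≤ _
    rw [hdec]
    refine (norm_add₃_le).trans ?_
    rw [norm_smul, norm_smul, norm_coe_sphere, Real.norm_eq_abs, mul_one,
      Real.norm_of_nonneg hb0]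
    have hx₀ : ‖(x₀ : Ambient n)‖ = X := by
      rw [he_def, norm_smul, norm_inv, Real.norm_of_nonneg hX.le, inv_mul_eq_one₀ hX.ne'] at he
      exact he.symm
    rw [hx₀]
  exact le_of_flat_estimates hr hX hρ.le hρ1 hρ3 hρ4 hb0 hd0 ha hbr hdle

/-- The boundary of a spherical convex body with interior points is, near each of its points,
projected bi-Lipschitzly along that point and the direction of an interior point. -/
lemma exists_dist_le_mul_dist_flatProj {B : Set (USphere n)} (hB : IsSphericalConvexBody B)
    {x₀ : SphereTangent w} (hx₀ : x₀ ∈ interior (gnomonicImage w B)) (h0 : x₀ ≠ 0) :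
    ∃ ρ > 0, ∃ K > 0, ∀ x ∈ frontier B ∩ Metric.ball w ρ, ∀ y ∈ frontier B ∩ Metric.ball w ρ,
      dist x y ≤ K * dist (flatProj w (‖x₀‖⁻¹ • x₀) x) (flatProj w (‖x₀‖⁻¹ • x₀) y) := by
  obtain ⟨r, hr, hball⟩ := exists_ball_subset_radialExtension hx₀
  set X := ‖x₀‖
  have hX : 0 < X := norm_pos_iff.2 h0
  set e := X⁻¹ • x₀ with he_def
  have he : ‖e‖ = 1 := by
    rw [he_def, norm_smul, norm_inv, norm_norm, inv_mul_cancel₀ hX.ne']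
  set ρ := min (min (1 / 4) (X / 4)) (min (r / 2) (r / (2 * X))) with hρ_def
  have hρ : 0 < ρ := by positivity
  have hρ1 : ρ ≤ 1 / 4 := (min_le_left _ _).trans (min_le_left _ _)
  have hρ2 : ρ ≤ X / 4 := (min_le_left _ _).trans (min_le_right _ _)
  have hρ3 : ρ ≤ r / 2 := (min_le_right _ _).trans (min_le_left _ _)
  have hρ4 : 2 * X * ρ ≤ r := by
    have : ρ ≤ r / (2 * X) := (min_le_right _ _).trans (min_le_right _ _)
    rw [le_div_iff₀ (by positivity)] at this
    linarith
  set K := 2 * (2 * X / r + 1) with hK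
  have key : ∀ x ∈ frontier B ∩ Metric.ball w ρ, ∀ y ∈ frontier B ∩ Metric.ball w ρ,
      0 ≤ ⟪horizontal (w : Ambient n) ((y : Ambient n) - x), e⟫ →
      dist x y ≤ K * dist (flatProj w e x) (flatProj w e y) := fun x hx y hy hpos =>
    dist_le_mul_dist_flatProj_of_nonneg hB hr hball hX he_def he hρ hρ1 hρ2 hρ3 hρ4 hx.1 hx.2
      hy.1 hy.2 hpos
  refine ⟨ρ, hρ, K, by positivity, fun x hx y hy => ?_⟩
  rcases le_total 0 ⟪horizontal (w : Ambient n) ((y : Ambient n) - x), e⟫ with h | h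
  · exact key x hx y hy h
  · rw [dist_comm x y, dist_comm (flatProj w e x)]
    refine key y hy x hx ?_
    have h1 : horizontal (w : Ambient n) ((x : Ambient n) - y) =
        -horizontal (w : Ambient n) ((y : Ambient n) - x) := by
      rw [horizontal, horizontal, ← map_neg, neg_sub]
    rw [h1, inner_neg_left]
    linarith

lemma dist_flatProj_le (e : SphereTangent w) (x y : USphere n) :
    dist (flatProj w e x) (flatProj w e y) ≤ dist x y := by
  rw [dist_eq_norm, Subtype.dist_eq, dist_eq_norm]
  exact (norm_horizontal_sub_le _ _ _).trans (norm_horizontal_sub_le _ _ _)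

/-- Nested spherical convex bodies have the same curvature at almost all common boundary points. -/
theorem euclideanHausdorffMeasure_sphericalCurvature_ne (hn : 2 ≤ n) {A B : Set (USphere n)}
    (hA : IsSphericalConvexBody A) (hB : IsSphericalConvexBody B) (hAB : A ⊆ B) :
    μHE[n - 1] {w ∈ A ∩ frontier B | sphericalCurvature A w ≠ sphericalCurvature B w} = 0 := by
  -- The chart exists only near a given point, so nullity is checked locally.
  refine measure_null_of_locally_null _ fun w hw => ?_
  obtain ⟨⟨hwA, hwB⟩, hne⟩ := hw
  set Z := {w ∈ A ∩ frontier B | sphericalCurvature A w ≠ sphericalCurvature B w}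
  -- Without interior both images lie in hyperplanes and both curvatures vanish, contrary to `hne`.
  have hint : (interior (gnomonicImage w B)).Nonempty := by
    by_contra he
    rw [not_nonempty_iff_eq_empty] at he
    have heA : interior (gnomonicImage w A) = ∅ := by
      refine subset_empty_iff.1 (he ▸ interior_mono ?_)
      rw [gnomonicImage_eq_preimage, gnomonicImage_eq_preimage]; exact preimage_mono hAB
    refine hne ?_
    rw [sphericalCurvature, sphericalCurvature,
      hA.convex_gnomonicImage.gaussKroneckerCurvature_eq_zero (zero_mem_gnomonicImage.2 hwA) heA,
      hB.convex_gnomonicImage.gaussKroneckerCurvature_eq_zero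
        (zero_mem_gnomonicImage.2 (hAB hwA)) he]
  obtain ⟨x₀, hx₀⟩ := hint
  have h0 : x₀ ≠ 0 := by
    rintro rfl
    rw [interior_gnomonicImage, mem_preimage, gnomonicInv_zero] at hx₀
    rw [hB.1.frontier_eq] at hwB
    exact hwB.2 hx₀
  obtain ⟨ρ, hρ, K, hK, H⟩ := exists_dist_le_mul_dist_flatProj hB hx₀ h0
  set e := ‖x₀‖⁻¹ • x₀
  have he0 : e ≠ 0 := smul_ne_zero (inv_ne_zero (norm_ne_zero_iff.2 h0)) h0
  have hfin : Module.finrank ℝ (ℝ ∙ e)ᗮ = n - 1 := by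
    have : Fact (Module.finrank ℝ (SphereTangent w) = (n - 1) + 1) :=
      ⟨by rw [finrank_sphereTangent]; omega⟩
    exact Submodule.finrank_orthogonal_span_singleton he0
  set U := Metric.ball w ρ
  have hnull := euclideanHausdorffMeasure_not_nonporousAt_eq_zero
    (M := (A ∩ frontier B) ∩ U) (S := frontier B ∩ U) (inter_subset_inter_left _ inter_subset_right)
    (p := fun v => flatProj w e v) hK (fun x _ y _ => dist_flatProj_le e x y) H
  rw [hfin] at hnull
  refine ⟨Z ∩ U, inter_mem_nhdsWithin Z (Metric.ball_mem_nhds w hρ), measure_mono_null ?_ hnull⟩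
  rintro v ⟨⟨⟨hvA, hvB⟩, hvne⟩, hvU⟩
  refine ⟨⟨⟨hvA, hvB⟩, hvU⟩, fun hnp => hvne ?_⟩
  exact sphericalCurvature_eq_of_nonporousAt hn hA hB hAB hvA hvB
    (NonporousAt.of_inter (Metric.isOpen_ball.mem_nhds hvU)
      (hnp.mono inter_subset_left subset_rfl))

end Chart

/-! ### Splitting the floating measure -/

section Valuation

variable {n : ℕ}

/-- The density of the floating measure. -/
noncomputable def floatingDensity (K : Set (USphere n)) (w : USphere n) : ℝ≥0∞ :=
  ENNReal.ofReal (sphericalCurvature K w ^ (1 / ((n : ℝ) + 1)))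

lemma setLIntegral_floatingDensity_congr {A B S : Set (USphere n)} (hS : MeasurableSet S)
    (h : μHE[n - 1] {w ∈ S | sphericalCurvature A w ≠ sphericalCurvature B w} = 0) :
    ∫⁻ w in S, floatingDensity A w ∂μHE[n - 1] = ∫⁻ w in S, floatingDensity B w ∂μHE[n - 1] := by
  refine setLIntegral_congr_fun_ae hS ?_
  rw [ae_iff]
  refine measure_mono_null (fun w hw => ?_) h
  simp only [mem_ofPred_eq, Classical.not_imp] at hw
  exact ⟨hw.1, fun hc => hw.2 (by rw [floatingDensity, floatingDensity, hc])⟩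

/-- When all of `frontier B` near `w` is in contact with `A`, nonporosity is automatic; this gives
equality at every point off the common boundary. -/
lemma sphericalCurvature_eq_of_eventually (hn : 2 ≤ n) {A B : Set (USphere n)}
    (hA : IsSphericalConvexBody A) (hB : IsSphericalConvexBody B) (hAB : A ⊆ B) {w : USphere n}
    {U : Set (USphere n)} (hU : U ∈ 𝓝 w) (hBA : frontier B ∩ U ⊆ A) (hwB : w ∈ frontier B) :
    sphericalCurvature A w = sphericalCurvature B w :=
  sphericalCurvature_eq_of_nonporousAt hn hA hB hAB (hBA ⟨hwB, mem_of_mem_nhds hU⟩) hwB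
    (NonporousAt.of_inter hU (nonporousAt_of_subset fun _ hx => ⟨hBA hx, hx.1⟩))

lemma sphericalCurvature_union_eq_of_notMem (hn : 2 ≤ n) {K L : Set (USphere n)}
    (hK : IsSphericalConvexBody K) (hL : IsClosed L) (hKL : IsSphericalConvexBody (K ∪ L))
    {w : USphere n} (hw : w ∈ frontier K) (hwL : w ∉ L) :
    sphericalCurvature K w = sphericalCurvature (K ∪ L) w := by
  refine sphericalCurvature_eq_of_eventually hn hK hKL subset_union_left
    (hL.isOpen_compl.mem_nhds hwL) ?_ ?_
  · rintro v ⟨hv, hvL⟩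
    exact (hKL.1.frontier_subset hv).resolve_right hvL
  · rw [hKL.1.frontier_eq]
    rw [hK.1.frontier_eq] at hw
    exact ⟨Or.inl hw.1, fun h => hw.2 (hL.mem_interior_of_mem_interior_union hwL h)⟩

lemma sphericalCurvature_inter_eq_of_mem_interior (hn : 2 ≤ n) {K L : Set (USphere n)}
    (hK : IsSphericalConvexBody K) (hL : IsSphericalConvexBody L)
    {w : USphere n} (hw : w ∈ frontier K) (hwL : w ∈ interior L) :
    sphericalCurvature (K ∩ L) w = sphericalCurvature K w := by
  refine sphericalCurvature_eq_of_eventually hn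
    (hK.inter hL ⟨w, hK.1.frontier_subset hw, interior_subset hwL⟩) hK inter_subset_left
    (isOpen_interior.mem_nhds hwL) ?_ hw
  rintro v ⟨hv, hvL⟩
  exact ⟨hK.1.frontier_subset hv, interior_subset hvL⟩

lemma setLIntegral_floatingDensity_eq_zero {A S : Set (USphere n)} (hS : MeasurableSet S)
    (h : ∀ w ∈ S, sphericalCurvature A w = 0) :
    ∫⁻ w in S, floatingDensity A w ∂μHE[n - 1] = 0 := by
  refine setLIntegral_eq_zero hS fun w hw => ?_
  -- A zero exponent would give `0 ^ 0 = 1`.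
  have hn : (1 : ℝ) / ((n : ℝ) + 1) ≠ 0 := by positivity
  rw [floatingDensity, h w hw, Real.zero_rpow hn, ENNReal.ofReal_zero, Pi.zero_apply]

/-- The parts of the boundary of `K` outside `L`, inside `L` and on the boundary of `L`. -/
lemma IsClosed.floatingMeasure_eq {K L : Set (USphere n)} (hL : IsClosed L)
    {ω : Set (USphere n)} (hω : MeasurableSet ω) :
    floatingMeasure K ω =
      ∫⁻ w in ω ∩ (frontier K \ L), floatingDensity K w ∂μHE[n - 1] +
      ∫⁻ w in ω ∩ (frontier K ∩ interior L), floatingDensity K w ∂μHE[n - 1] +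
      ∫⁻ w in ω ∩ (frontier K ∩ frontier L), floatingDensity K w ∂μHE[n - 1] := by
  have hm : MeasurableSet (frontier L) := measurableSet_frontier
  have hmK : MeasurableSet (frontier K) := measurableSet_frontier
  have hmi : MeasurableSet (interior L) := measurableSet_interior
  rw [← lintegral_union (hω.inter (hmK.inter hmi)), ← lintegral_union (hω.inter (hmK.inter hm))]
  · change ∫⁻ w in ω ∩ frontier K, floatingDensity K w ∂μHE[n - 1] = _
    congr 2
    ext w
    have h := hL.frontier_eq
    have hi : w ∈ interior L → w ∈ L := fun hw => interior_subset hw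
    simp only [h, mem_inter_iff, mem_union, Set.mem_sdiff]
    tauto
  · rw [Set.disjoint_left]
    rw [hL.frontier_eq]
    rintro w (hw | hw) hw'
    · exact hw.2.2 hw'.2.2.1
    · exact hw'.2.2.2 hw.2.2
  · rw [Set.disjoint_left]
    exact fun w hw hw' => hw.2.2 (interior_subset hw'.2.2)

end Valuation

theorem theorem7p2 (n : ℕ) (hn : 2 ≤ n) (K L : Set (USphere n))
    (hK : IsSphericalConvexBody K) (hL : IsSphericalConvexBody L)
    (hKL : IsSphericalConvexBody (K ∪ L)) (ω : Set (USphere n)) (hω : MeasurableSet ω) :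
    floatingMeasure K ω + floatingMeasure L ω =
      floatingMeasure (K ∪ L) ω + floatingMeasure (K ∩ L) ω := by
  have hmK : MeasurableSet (frontier K) := measurableSet_frontier
  have hmL : MeasurableSet (frontier L) := measurableSet_frontier
  have hmU : MeasurableSet (frontier (K ∪ L)) := measurableSet_frontier
  have hmiK : MeasurableSet (interior K) := measurableSet_interior
  have hmiL : MeasurableSet (interior L) := measurableSet_interior
  have hmiU : MeasurableSet (interior (K ∪ L)) := measurableSet_interior
  have hfK := hK.1.frontier_eq
  have hfL := hL.1.frontier_eq
  have hfU := hKL.1.frontier_eq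
  set R₁ := ω ∩ (frontier K \ L) with hR₁
  set R₂ := ω ∩ (frontier K ∩ interior L) with hR₂
  set R₃ := ω ∩ (frontier L \ K) with hR₃
  set R₄ := ω ∩ (frontier L ∩ interior K) with hR₄
  set M := ω ∩ (frontier K ∩ frontier L) with hM
  set M₁ := M ∩ frontier (K ∪ L) with hM₁
  set M₂ := M ∩ interior (K ∪ L) with hM₂
  have hmR₁ : MeasurableSet R₁ := hω.inter (hmK.diff hL.1.measurableSet)
  have hmR₂ : MeasurableSet R₂ := hω.inter (hmK.inter hmiL)
  have hmR₃ : MeasurableSet R₃ := hω.inter (hmL.diff hK.1.measurableSet)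
  have hmR₄ : MeasurableSet R₄ := hω.inter (hmL.inter hmiK)
  have hmM : MeasurableSet M := hω.inter (hmK.inter hmL)
  have hmM₁ : MeasurableSet M₁ := hmM.inter hmU
  have hmM₂ : MeasurableSet M₂ := hmM.inter hmiU
  have hMsplit : M = M₁ ∪ M₂ := by
    rw [hM₁, hM₂, ← inter_union_distrib_left, eq_comm, inter_eq_left]
    intro w hw
    have h1 : w ∈ K := hK.1.frontier_subset hw.2.1
    rw [hfU]
    by_cases h : w ∈ interior (K ∪ L)
    · exact Or.inr h
    · exact Or.inl ⟨Or.inl h1, h⟩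
  have hMdisj : Disjoint M₁ M₂ := by
    rw [Set.disjoint_left, hM₁, hfU]
    exact fun w hw hw' => hw.2.2 hw'.2
  have hsplit : ∀ A : Set (USphere n), ∫⁻ w in M, floatingDensity A w ∂μHE[n - 1] =
      ∫⁻ w in M₁, floatingDensity A w ∂μHE[n - 1] +
        ∫⁻ w in M₂, floatingDensity A w ∂μHE[n - 1] := fun A => by
    rw [hMsplit, lintegral_union hmM₂ hMdisj]
  have hzero := fun w (hw : w ∈ M₂) =>
    sphericalCurvature_eq_zero_of_union_mem_nhds hn hK hL hw.1.2.1 hw.1.2.2 hw.2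
  have hzeroL : ∀ w ∈ M₂, sphericalCurvature L w = 0 := fun w hw =>
    (sphericalCurvature_eq_zero_of_union_mem_nhds hn hL hK hw.1.2.2 hw.1.2.1
      (union_comm K L ▸ hw.2)).1
  have hae : ∀ A : Set (USphere n), IsSphericalConvexBody A → A ⊆ K ∪ L → M ⊆ A →
      ∫⁻ w in M₁, floatingDensity A w ∂μHE[n - 1] =
        ∫⁻ w in M₁, floatingDensity (K ∪ L) w ∂μHE[n - 1] := fun A hA hAU hMA => by
    refine setLIntegral_floatingDensity_congr hmM₁ (measure_mono_null ?_
      (euclideanHausdorffMeasure_sphericalCurvature_ne hn hA hKL hAU))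
    exact fun w hw => ⟨⟨hMA hw.1.1, hw.1.2⟩, hw.2⟩
  have hpt : ∀ A B S : Set (USphere n), MeasurableSet S →
      (∀ w ∈ S, sphericalCurvature A w = sphericalCurvature B w) →
      ∫⁻ w in S, floatingDensity A w ∂μHE[n - 1] =
        ∫⁻ w in S, floatingDensity B w ∂μHE[n - 1] := fun A B S hS h =>
    setLIntegral_congr_fun hS fun w hw => by simp only [floatingDensity, h w hw]
  have hMK : M ⊆ K := fun w hw => hK.1.frontier_subset hw.2.1
  have hML : M ⊆ L := fun w hw => hL.1.frontier_subset hw.2.2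
  have hM₁I : ∫⁻ w in M₁, floatingDensity (K ∩ L) w ∂μHE[n - 1] =
      ∫⁻ w in M₁, floatingDensity (K ∪ L) w ∂μHE[n - 1] := by
    -- `IsSphericalConvexBody.inter` needs a common point; without one `M₁` is empty.
    rcases (K ∩ L).eq_empty_or_nonempty with he | hne
    · have : M₁ = ∅ := subset_empty_iff.1 (he ▸ fun w hw => ⟨hMK hw.1, hML hw.1⟩)
      rw [this, Measure.restrict_empty, lintegral_zero_measure, lintegral_zero_measure]
    · exact hae _ (hK.inter hL hne) (inter_subset_left.trans subset_union_left)
        (subset_inter hMK hML)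
  have eK : floatingMeasure K ω = ∫⁻ w in R₁, floatingDensity (K ∪ L) w ∂μHE[n - 1] +
      ∫⁻ w in R₂, floatingDensity (K ∩ L) w ∂μHE[n - 1] +
      ∫⁻ w in M₁, floatingDensity (K ∪ L) w ∂μHE[n - 1] := by
    rw [hL.1.floatingMeasure_eq hω, hsplit, hae K hK subset_union_left hMK,
      setLIntegral_floatingDensity_eq_zero hmM₂ fun w hw => (hzero w hw).1, add_zero,
      hpt K (K ∪ L) R₁ hmR₁ fun w hw =>
        sphericalCurvature_union_eq_of_notMem hn hK hL.1 hKL hw.2.1 hw.2.2,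
      hpt K (K ∩ L) R₂ hmR₂ fun w hw =>
        (sphericalCurvature_inter_eq_of_mem_interior hn hK hL hw.2.1 hw.2.2).symm]
  have eL : floatingMeasure L ω = ∫⁻ w in R₃, floatingDensity (K ∪ L) w ∂μHE[n - 1] +
      ∫⁻ w in R₄, floatingDensity (K ∩ L) w ∂μHE[n - 1] +
      ∫⁻ w in M₁, floatingDensity (K ∪ L) w ∂μHE[n - 1] := by
    rw [hK.1.floatingMeasure_eq hω, inter_comm (frontier L) (frontier K), hsplit,
      hae L hL subset_union_right hML,
      setLIntegral_floatingDensity_eq_zero hmM₂ hzeroL, add_zero,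
      hpt L (K ∪ L) R₃ hmR₃ fun w hw => by
        rw [union_comm]
        exact sphericalCurvature_union_eq_of_notMem hn hL hK.1 (union_comm K L ▸ hKL) hw.2.1 hw.2.2,
      hpt L (K ∩ L) R₄ hmR₄ fun w hw => by
        rw [inter_comm]
        exact (sphericalCurvature_inter_eq_of_mem_interior hn hL hK hw.2.1 hw.2.2).symm]
  have eU : floatingMeasure (K ∪ L) ω = ∫⁻ w in R₁, floatingDensity (K ∪ L) w ∂μHE[n - 1] +
      ∫⁻ w in R₃, floatingDensity (K ∪ L) w ∂μHE[n - 1] +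
      ∫⁻ w in M₁, floatingDensity (K ∪ L) w ∂μHE[n - 1] := by
    rw [← lintegral_union hmR₃, ← lintegral_union hmM₁]
    · change ∫⁻ w in ω ∩ frontier (K ∪ L), floatingDensity (K ∪ L) w ∂μHE[n - 1] = _
      congr 2
      rw [hR₁, hR₃, hM₁, hM, inter_assoc ω, ← inter_union_distrib_left, ← inter_union_distrib_left,
        ← hK.1.frontier_union_eq hL.1]
    · rw [Set.disjoint_left]
      rintro w (hw | hw) hw'
      · exact hw.2.2 (hML hw'.1)
      · exact hw.2.2 (hMK hw'.1)
    · rw [Set.disjoint_left]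
      exact fun w hw hw' => hw'.2.2 (hK.1.frontier_subset hw.2.1)
  have eI : floatingMeasure (K ∩ L) ω = ∫⁻ w in R₂, floatingDensity (K ∩ L) w ∂μHE[n - 1] +
      ∫⁻ w in R₄, floatingDensity (K ∩ L) w ∂μHE[n - 1] +
      ∫⁻ w in M₁, floatingDensity (K ∪ L) w ∂μHE[n - 1] := by
    -- The boundary of `K ∩ L` contains all of `M`; the vanishing integral over `M₂` is inserted to
    -- complete `M₁` to `M`.
    rw [← hM₁I, ← add_zero (∫⁻ w in M₁, floatingDensity (K ∩ L) w ∂μHE[n - 1]),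
      ← setLIntegral_floatingDensity_eq_zero hmM₂ fun w hw => (hzero w hw).2, ← hsplit,
      ← lintegral_union hmR₄, ← lintegral_union hmM]
    · change ∫⁻ w in ω ∩ frontier (K ∩ L), floatingDensity (K ∩ L) w ∂μHE[n - 1] = _
      congr 2
      rw [hR₂, hR₄, hM, ← inter_union_distrib_left, ← inter_union_distrib_left,
        ← hK.1.frontier_inter_eq hL.1]
    · rw [Set.disjoint_left]
      rintro w (hw | hw) hw'
      · exact (hfL ▸ hw'.2.2).2 hw.2.2
      · exact (hfK ▸ hw'.2.1).2 hw.2.2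
    · rw [Set.disjoint_left]
      exact fun w hw hw' => (hfK ▸ hw.2.1 : w ∈ K \ interior K).2 hw'.2.2
  rw [eK, eL, eU, eI]
  abel
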